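/- Let $\alpha\in\mathbb R$ and $\vartheta\in(0,\pi)$. Let $\Gamma_\vartheta$ be the chain graph consisting of rings numbered by $j\in\mathbb Z$, each made of an upper and a lower arm; all arms have length $\pi$, except that the upper and lower arm of ring $0$ have lengths $\pi+\vartheta$ and $\pi-\vartheta$. For every $j$, the right ends of the two arms of ring $j-1$ and the left ends of the two arms of ring $j$ are joined in one vertex. Let $H_\vartheta$ be the operator in $L^2(\Gamma_\vartheta)$ which acts as $\psi\mapsto-\psi''$ on each arm, its domain being the set of all $\psi\in L^2(\Gamma_\vartheta)$ with components in $W^{2,2}$ and $\psi''\in L^2(\Gamma_\vartheta)$ that are continuous at every vertex and satisfy there the $\delta$-coupling condition: the sum of the outgoing derivatives equals $\alpha$ times the value of $\psi$. Let $H^+$ be the part of $H_\vartheta$ in the subspace of functions that are even under the mirror reflection of $\Gamma_\vartheta$ about the axis of ring $0$ (which maps the point at distance $x$ from the left end of an arm of ring $j$ to the point at distance $x$ from the right end of the corresponding arm of ring $-j$). Let $H_0$ denote the Hamiltonian of the straight chain ($\vartheta=0$) with the same $\alpha$; its spectrum is the union of the spectral bands. (i) If $\alpha\ge 0$, then $H^+$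 has no negative eigenvalues. (ii) If $\alpha<0$, then the equation $\kappa\tanh\kappa\pi=-\alpha/2$ has a unique solution $\kappa_0>0$, and $H^+$ has at least one negative eigenvalue $E$ that satisfies $E>-\kappa_0^2$ and lies below the lowest spectral band, that is, $E<s$ for every real $s\in\sigma(H_0)$. -/

import Mathlib

open MeasureTheory Set

noncomputable section

namespace BentChain

/-- The edges of the chain: ring number `j : ℤ` together with the arm of that ring, the upper one
(`true`) or the lower one (`false`). -/
abbrev Edge : Type := ℤ × Bool

/-- Lengths of the edges of the chain graph with bending angle `ϑ`.  All arms have length `π`,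
except for those of ring `0`, which have lengths `π + ϑ` (upper) and `π - ϑ` (lower).
The value `ϑ = 0` gives the straight chain. -/
def edgeLength (ϑ : ℝ) (e : Edge) : ℝ :=
  if e.1 = 0 then (if e.2 then Real.pi + ϑ else Real.pi - ϑ) else Real.pi

/-- Lebesgue measure on an edge of length `ℓ`, parametrized by `(0, ℓ]`. -/
abbrev edgeMeasure (ℓ : ℝ) : Measure ℝ := volume.restrict (Ioc 0 ℓ)

/-- Square integrable functions on an edge of length `ℓ`. -/
abbrev EdgeL2 (ℓ : ℝ) : Type := Lp ℂ 2 (edgeMeasure ℓ)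

/-- The state space `L²(Γ_ϑ)`: the Hilbert space direct sum of the `L²` spaces of the edges. -/
abbrev StateSpace (ϑ : ℝ) : Type := lp (fun e : Edge => EdgeL2 (edgeLength ϑ e)) 2

/-- `f ∈ W^{2,2}(0, ℓ)` with second derivative `g ∈ L²(0, ℓ)`: the function `u` is the `C¹`
representative of `f` on `[0, ℓ]`, with derivative `v`, and `v` is absolutely continuous with
derivative `g`, i.e. it is the indefinite integral of `g`. -/
structure IsSobolevRep (ℓ : ℝ) (f g : EdgeL2 ℓ) (u v : ℝ → ℂ) : Prop where
  ae_eq : f =ᵐ[edgeMeasure ℓ] u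
  hasDeriv : ∀ x ∈ Icc 0 ℓ, HasDerivWithinAt u (v x) (Icc 0 ℓ) x
  deriv_eq : ∀ x ∈ Icc 0 ℓ, v x = v 0 + ∫ t in (0 : ℝ)..x, g t

/-- The `δ`-coupling with parameter `α` at all vertices, for a function with components `u e` and
derivatives `v e`.  Vertex `j` joins the right ends of both arms of ring `j - 1` to the left ends of
both arms of ring `j`.  The function is continuous at the vertex, and the sum of its outgoing
derivatives is `α` times its value there. -/
structure DeltaCoupling (ϑ α : ℝ) (u v : Edge → ℝ → ℂ) : Prop where
  lower_left : ∀ j : ℤ, u (j, false) 0 = u (j, true) 0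
  upper_right : ∀ j : ℤ, u (j - 1, true) (edgeLength ϑ (j - 1, true)) = u (j, true) 0
  lower_right : ∀ j : ℤ, u (j - 1, false) (edgeLength ϑ (j - 1, false)) = u (j, true) 0
  flux : ∀ j : ℤ,
    v (j, true) 0 + v (j, false) 0
      - v (j - 1, true) (edgeLength ϑ (j - 1, true))
      - v (j - 1, false) (edgeLength ϑ (j - 1, false)) = (α : ℂ) * u (j, true) 0

theorem EdgeL2.intervalIntegrable {ℓ : ℝ} (g : EdgeL2 ℓ) {x : ℝ} (hx : x ∈ Icc 0 ℓ) :
    IntervalIntegrable g volume 0 x := by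
  rw [intervalIntegrable_iff_integrableOn_Ioc_of_le hx.1]
  have h : Integrable g (edgeMeasure ℓ) := (Lp.memLp g).integrable (by norm_num)
  exact IntegrableOn.mono_set h (Ioc_subset_Ioc_right hx.2)

theorem EdgeL2.integral_congr {ℓ : ℝ} {f g : ℝ → ℂ} (h : f =ᵐ[edgeMeasure ℓ] g) {x : ℝ}
    (hx : x ∈ Icc 0 ℓ) : ∫ t in (0 : ℝ)..x, f t = ∫ t in (0 : ℝ)..x, g t := by
  rw [intervalIntegral.integral_of_le hx.1, intervalIntegral.integral_of_le hx.1]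
  exact MeasureTheory.integral_congr_ae
    (ae_mono (Measure.restrict_mono (Ioc_subset_Ioc_right hx.2) le_rfl) h)

theorem IsSobolevRep.zero (ℓ : ℝ) : IsSobolevRep ℓ 0 0 0 0 where
  ae_eq := Lp.coeFn_zero _ _ _
  hasDeriv x _ := hasDerivWithinAt_const x (Icc 0 ℓ) (0 : ℂ)
  deriv_eq x hx := by
    rw [EdgeL2.integral_congr (Lp.coeFn_zero _ _ _) hx]
    simp

theorem IsSobolevRep.add {ℓ : ℝ} {f g f' g' : EdgeL2 ℓ} {u v u' v' : ℝ → ℂ}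
    (h : IsSobolevRep ℓ f g u v) (h' : IsSobolevRep ℓ f' g' u' v') :
    IsSobolevRep ℓ (f + f') (g + g') (u + u') (v + v') where
  ae_eq := (Lp.coeFn_add f f').trans (h.ae_eq.add h'.ae_eq)
  hasDeriv x hx := (h.hasDeriv x hx).add (h'.hasDeriv x hx)
  deriv_eq x hx := by
    rw [EdgeL2.integral_congr (Lp.coeFn_add g g') hx]
    simp only [Pi.add_apply]
    rw [intervalIntegral.integral_add (g.intervalIntegrable hx) (g'.intervalIntegrable hx),
      h.deriv_eq x hx, h'.deriv_eq x hx]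
    ring

theorem IsSobolevRep.smul {ℓ : ℝ} {f g : EdgeL2 ℓ} {u v : ℝ → ℂ} (c : ℂ)
    (h : IsSobolevRep ℓ f g u v) : IsSobolevRep ℓ (c • f) (c • g) (c • u) (c • v) where
  ae_eq := (Lp.coeFn_smul c f).trans (h.ae_eq.const_smul c)
  hasDeriv x hx := (h.hasDeriv x hx).const_smul c
  deriv_eq x hx := by
    rw [EdgeL2.integral_congr (Lp.coeFn_smul c g) hx]
    simp only [Pi.smul_apply, intervalIntegral.integral_smul]
    rw [h.deriv_eq x hx, smul_add]

/-- The graph of the Hamiltonian: all pairs `(ψ, -ψ'')` with `ψ, ψ'' ∈ L²(Γ_ϑ)`, all components of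
`ψ` in `W^{2,2}`, and `ψ` satisfying the `δ`-coupling at every vertex. -/
def hamiltonianGraph (ϑ α : ℝ) : Submodule ℂ (StateSpace ϑ × StateSpace ϑ) where
  carrier := {p | ∃ u v : Edge → ℝ → ℂ,
    (∀ e, IsSobolevRep (edgeLength ϑ e) (p.1 e) (-(p.2 e)) (u e) (v e)) ∧ DeltaCoupling ϑ α u v}
  zero_mem' := by
    refine ⟨fun _ => 0, fun _ => 0, fun e => ?_, ?_⟩
    · simpa using IsSobolevRep.zero (edgeLength ϑ e)
    · constructor <;> simp
  add_mem' := by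
    rintro p q ⟨u, v, h, hd⟩ ⟨u', v', h', hd'⟩
    refine ⟨u + u', v + v', fun e => ?_, ?_⟩
    · have := (h e).add (h' e)
      simpa [neg_add, add_comm] using this
    · constructor <;> intro j
      · simp [hd.lower_left j, hd'.lower_left j]
      · simp [hd.upper_right j, hd'.upper_right j]
      · simp [hd.lower_right j, hd'.lower_right j]
      · have h1 := hd.flux j
        have h2 := hd'.flux j
        simp only [Pi.add_apply]
        linear_combination h1 + h2
  smul_mem' := by
    rintro c p ⟨u, v, h, hd⟩
    refine ⟨c • u, c • v, fun e => ?_, ?_⟩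
    · have := (h e).smul c
      simpa using this
    · constructor <;> intro j
      · simp [hd.lower_left j]
      · simp [hd.upper_right j]
      · simp [hd.lower_right j]
      · have h1 := hd.flux j
        simp only [Pi.smul_apply, smul_eq_mul]
        linear_combination c * h1

/-- The Hamiltonian `H_ϑ` on the chain with bending angle `ϑ` and `δ`-coupling `α`: the operator
`ψ ↦ -ψ''` in `L²(Γ_ϑ)` whose graph is `hamiltonianGraph ϑ α`. -/
def hamiltonian (ϑ α : ℝ) : StateSpace ϑ →ₗ.[ℂ] StateSpace ϑ :=
  (hamiltonianGraph ϑ α).toLinearPMap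

theorem IsSobolevRep.eq_zero {ℓ : ℝ} {g : EdgeL2 ℓ} {u v : ℝ → ℂ}
    (h : IsSobolevRep ℓ 0 g u v) : g = 0 := by
  rcases le_or_gt ℓ 0 with hℓ | hℓ
  · have : edgeMeasure ℓ = 0 := by simp [edgeMeasure, Ioc_eq_empty_of_le hℓ]
    apply Lp.ext
    have hb : ae (edgeMeasure ℓ) = ⊥ := by rw [this]; exact ae_zero
    simp [Filter.EventuallyEq, hb]
  have hu0 : ∀ x ∈ Icc 0 ℓ, u x = 0 := by
    have hc : ContinuousOn u (Icc 0 ℓ) := fun x hx => (h.hasDeriv x hx).continuousWithinAt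
    have hae : u =ᵐ[volume.restrict (Icc 0 ℓ)] (fun _ => (0 : ℂ)) := by
      rw [← Measure.restrict_congr_set (Ioc_ae_eq_Icc (a := (0 : ℝ)) (b := ℓ))]
      exact h.ae_eq.symm.trans (Lp.coeFn_zero _ _ _)
    exact Measure.eqOn_Icc_of_ae_eq volume hℓ.ne hae hc continuousOn_const
  have hv0 : ∀ x ∈ Icc 0 ℓ, v x = 0 := by
    intro x hx
    have h1 := h.hasDeriv x hx
    have h2 : HasDerivWithinAt u 0 (Icc 0 ℓ) x :=
      (hasDerivWithinAt_const x (Icc 0 ℓ) (0 : ℂ)).congr hu0 (hu0 x hx)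
    exact (uniqueDiffOn_Icc hℓ x hx).eq_deriv _ h1 h2
  have hint : ∀ x ∈ Icc 0 ℓ, ∫ t in (0 : ℝ)..x, g t = 0 := by
    intro x hx
    have := h.deriv_eq x hx
    rw [hv0 x hx, hv0 0 ⟨le_rfl, hℓ.le⟩] at this
    simpa using this.symm
  have hgi := g.intervalIntegrable (x := ℓ) ⟨hℓ.le, le_rfl⟩
  apply Lp.ext
  refine Filter.EventuallyEq.trans ?_ (Lp.coeFn_zero _ _ _).symm
  change g =ᵐ[volume.restrict (Ioc 0 ℓ)] (fun _ => (0 : ℂ))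
  have hr : volume.restrict (Ioc 0 ℓ) = volume.restrict (Ioo 0 ℓ) :=
    (Measure.restrict_congr_set (Ioo_ae_eq_Ioc (a := (0 : ℝ)) (b := ℓ))).symm
  have hae : ae (volume.restrict (Ioc 0 ℓ)) = ae (volume.restrict (Ioo 0 ℓ)) := by rw [hr]
  rw [hae]
  rw [Filter.EventuallyEq, ae_restrict_iff' measurableSet_Ioo]
  filter_upwards [hgi.ae_hasDerivAt_integral] with x hx hxI
  have h1 := hx (by rw [uIcc_of_le hℓ.le]; exact ⟨hxI.1.le, hxI.2.le⟩) 0 left_mem_uIcc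
  have h2 : HasDerivAt (fun y => ∫ t in (0 : ℝ)..y, g t) 0 x := by
    refine (hasDerivAt_const x (0 : ℂ)).congr_of_eventuallyEq ?_
    filter_upwards [Icc_mem_nhds hxI.1 hxI.2] with y hy
    exact hint y hy
  exact h1.unique h2

theorem graph_hamiltonian (ϑ α : ℝ) : (hamiltonian ϑ α).graph = hamiltonianGraph ϑ α := by
  refine Submodule.toLinearPMap_graph_eq _ ?_
  rintro ⟨f, g⟩ ⟨u, v, h, -⟩ (hf : f = 0)
  subst hf
  ext1
  funext e
  have := (h e).eq_zero
  simpa using this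

theorem edgeLength_neg (ϑ : ℝ) (j : ℤ) (b : Bool) :
    edgeLength ϑ (-j, b) = edgeLength ϑ (j, b) := by
  simp [edgeLength]

/-- Statements true almost everywhere on an edge of ring `-j` are true almost everywhere at the
mirror images of the points of the corresponding edge of ring `j`. -/
theorem ae_reflect {ϑ : ℝ} {j : ℤ} {b : Bool} {p : ℝ → Prop}
    (h : ∀ᵐ x ∂(edgeMeasure (edgeLength ϑ (-j, b))), p x) :
    ∀ᵐ x ∂(edgeMeasure (edgeLength ϑ (j, b))), p (edgeLength ϑ (j, b) - x) := by
  rw [edgeLength_neg] at h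
  generalize edgeLength ϑ (j, b) = ℓ at h ⊢
  rw [edgeMeasure, ← Measure.restrict_congr_set (Ioo_ae_eq_Ioc (a := (0 : ℝ)) (b := ℓ)),
    ae_restrict_iff' measurableSet_Ioo] at h ⊢
  have hq := (Measure.measurePreserving_sub_left volume ℓ).quasiMeasurePreserving.ae h
  filter_upwards [hq] with x hx hxI
  exact hx ⟨by linarith [hxI.2], by linarith [hxI.1]⟩

/-- The functions on the chain that are even with respect to the mirror symmetry about the axis of
ring `0`, which maps the point `x` of an arm of ring `j` to the point `ℓ - x` of the same arm of
ring `-j`, where `ℓ` is the length of the arm. -/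
def evenSubspace (ϑ : ℝ) : Submodule ℂ (StateSpace ϑ) where
  carrier := {ψ | ∀ (j : ℤ) (b : Bool), ∀ᵐ x ∂(edgeMeasure (edgeLength ϑ (j, b))),
    ψ (-j, b) (edgeLength ϑ (j, b) - x) = ψ (j, b) x}
  zero_mem' := by
    intro j b
    filter_upwards [ae_reflect (Lp.coeFn_zero ℂ 2 (edgeMeasure (edgeLength ϑ (-j, b)))),
      Lp.coeFn_zero ℂ 2 (edgeMeasure (edgeLength ϑ (j, b)))] with x h1 h2
    exact h1.trans h2.symm
  add_mem' := by
    intro ψ φ hψ hφ j b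
    filter_upwards [ae_reflect (Lp.coeFn_add (ψ (-j, b)) (φ (-j, b))),
      Lp.coeFn_add (ψ (j, b)) (φ (j, b)), hψ j b, hφ j b] with x h1 h2 h3 h4
    refine h1.trans (Eq.trans ?_ h2.symm)
    simp only [Pi.add_apply, h3, h4]
  smul_mem' := by
    intro c ψ hψ j b
    filter_upwards [ae_reflect (Lp.coeFn_smul c (ψ (-j, b))),
      Lp.coeFn_smul c (ψ (j, b)), hψ j b] with x h1 h2 h3
    refine h1.trans (Eq.trans ?_ h2.symm)
    simp only [Pi.smul_apply, h3]

section Operators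

variable {H : Type*} [NormedAddCommGroup H] [NormedSpace ℂ H]

/-- The part of an operator `T` in a subspace `S`: it acts as `T`, as an operator in `S`, on all
`ψ ∈ S` in the domain of `T` for which `T ψ ∈ S`. -/
def partIn (T : H →ₗ.[ℂ] H) (S : Submodule ℂ H) : S →ₗ.[ℂ] S :=
  (T.graph.comap (S.subtype.prodMap S.subtype)).toLinearPMap

theorem graph_partIn (T : H →ₗ.[ℂ] H) (S : Submodule ℂ H) :
    (partIn T S).graph = T.graph.comap (S.subtype.prodMap S.subtype) := by
  refine Submodule.toLinearPMap_graph_eq _ ?_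
  rintro ⟨f, g⟩ hfg (hf : f = 0)
  subst hf
  exact Subtype.ext (LinearPMap.graph_fst_eq_zero_snd T hfg rfl)

/-- `z` is an eigenvalue of the operator `T`. -/
def IsEigenvalue (T : H →ₗ.[ℂ] H) (z : ℂ) : Prop :=
  ∃ ψ : T.domain, (ψ : H) ≠ 0 ∧ T ψ = z • (ψ : H)

/-- The resolvent set of the operator `T`: all `z` such that `T - z` is a bijection from the domain
of `T` onto the whole space with a bounded inverse `R`. -/
def resolventSet (T : H →ₗ.[ℂ] H) : Set ℂ :=
  {z | ∃ R : H →L[ℂ] H,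
    (∀ f : H, ∃ ψ : T.domain, (ψ : H) = R f ∧ T ψ - z • (ψ : H) = f) ∧
    ∀ ψ : T.domain, R (T ψ - z • (ψ : H)) = ψ}

/-- The spectrum of the operator `T`. -/
def opSpectrum (T : H →ₗ.[ℂ] H) : Set ℂ := (resolventSet T)ᶜ

end Operators

/-- The even part `H⁺` of the Hamiltonian `H_ϑ`: its part in the subspace of even functions. -/
def evenHamiltonian (ϑ α : ℝ) : evenSubspace ϑ →ₗ.[ℂ] evenSubspace ϑ :=
  partIn (hamiltonian ϑ α) (evenSubspace ϑ)

end BentChain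

end

noncomputable section

namespace BentChain

/-! At energy $-\kappa^2$ with $\kappa>0$, a solution on an edge is determined by its two end values
(`IsSobolevRep.eq_edgeSol`), so the eigenvalue problem reduces to the flux balance for the vertex
values $p_j$. Away from ring $0$ this reads $p_{j+1}+p_{j-1}=2\eta p_j$ with
$\eta=\cosh\kappa\pi+\frac{\alpha}{4\kappa}\sinh\kappa\pi$ (`dispersion`).

No negative eigenvalues: for $\alpha\ge 0$ the coefficient of $p_j$ exceeds the sum of the positive
coefficients of its neighbours, so a square-summable $p$ vanishes by a discrete maximum principle
(`eq_zero_of_mem_graph`).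

Existence: if $\eta>1$, the recurrence has the decaying solution with ratio
$r=\eta-\sqrt{\eta^2-1}$. Continuing it evenly across ring $0$ leaves one condition, at the ends of
that ring:
$\sqrt{\eta^2-1}+\frac{\alpha}{4\kappa}\sinh\kappa\pi+\frac{\sinh^2\kappa\pi}{\cosh\kappa\pi+\cosh\kappa\vartheta}=0$
(`isEigenvalue_of_secular`). The left side is negative at the $\kappa_1$ with $\eta=1$, because
$\vartheta>0$, and positive at $\kappa_0$, because $\vartheta<\pi$; hence there is a root in
$(\kappa_1,\kappa_0)$ (`exists_secular_root`).

Position below the bands: $\eta>1$ persists for all larger $\kappa$, and whenever $\eta>1$ the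
inhomogeneous recurrence is boundedly solvable in $\ell^2(\mathbb Z)$ by a Neumann series. Thus
$(-\infty,-\kappa^2]$ lies in the resolvent set of $H_0$ (`neg_sq_mem_resolventSet`,
`lt_of_mem_opSpectrum`). -/

theorem EdgeL2.ext_of_eqOn {ℓ : ℝ} {f g : EdgeL2 ℓ} {u : ℝ → ℂ}
    (hf : f =ᵐ[edgeMeasure ℓ] u) (hg : g =ᵐ[edgeMeasure ℓ] u) : f = g :=
  Lp.ext (hf.trans hg.symm)

theorem ae_edgeMeasure_of_forall {ℓ : ℝ} {p : ℝ → Prop} (h : ∀ x ∈ Icc 0 ℓ, p x) :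
    ∀ᵐ x ∂(edgeMeasure ℓ), p x :=
  (ae_restrict_iff' measurableSet_Ioc).2 (ae_of_all _ fun x hx => h x (Ioc_subset_Icc_self hx))

theorem memLp_of_continuous {u : ℝ → ℂ} (hu : Continuous u) (ℓ : ℝ) :
    MemLp u 2 (edgeMeasure ℓ) := by
  obtain ⟨C, hC⟩ := isCompact_Icc.exists_bound_of_continuousOn (s := Icc 0 ℓ) hu.continuousOn
  exact MemLp.of_bound hu.aestronglyMeasurable C (ae_edgeMeasure_of_forall hC)

/-- The restriction of a continuous function to an edge. -/
def ofContinuous (ℓ : ℝ) (u : ℝ → ℂ) (hu : Continuous u) : EdgeL2 ℓ :=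
  (memLp_of_continuous hu ℓ).toLp u

theorem coeFn_ofContinuous {ℓ : ℝ} {u : ℝ → ℂ} (hu : Continuous u) :
    ofContinuous ℓ u hu =ᵐ[edgeMeasure ℓ] u := MemLp.coeFn_toLp _

theorem norm_ofContinuous_le {ℓ : ℝ} {u : ℝ → ℂ} (hu : Continuous u) {C : ℝ} (hC : 0 ≤ C)
    (h : ∀ x ∈ Icc 0 ℓ, ‖u x‖ ≤ C) :
    ‖ofContinuous ℓ u hu‖ ≤ (measureUnivNNReal (edgeMeasure ℓ) : ℝ) ^ (1 / 2 : ℝ) * C := by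
  have := Lp.norm_le_of_ae_bound (f := ofContinuous ℓ u hu) hC (by
    filter_upwards [coeFn_ofContinuous (ℓ := ℓ) hu, ae_edgeMeasure_of_forall h] with x h1 h2
    rwa [h1])
  simpa using this

theorem EdgeL2.integral_norm_le {ℓ : ℝ} (f : EdgeL2 ℓ) :
    ∫ x, ‖f x‖ ∂(edgeMeasure ℓ) ≤
      ((edgeMeasure ℓ univ) ^ (1 - 1 / 2 : ℝ)).toReal * ‖f‖ := by
  have h := eLpNorm_le_eLpNorm_mul_rpow_measure_univ (p := 1) (q := 2) (μ := edgeMeasure ℓ)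
    (by norm_num) (Lp.aestronglyMeasurable f)
  rw [integral_norm_eq_lintegral_enorm (Lp.aestronglyMeasurable f), ← eLpNorm_one_eq_lintegral_enorm,
    mul_comm, Lp.norm_def, ← ENNReal.toReal_mul]
  refine ENNReal.toReal_mono ?_ ?_
  · exact ENNReal.mul_ne_top (Lp.eLpNorm_ne_top f)
      (ENNReal.rpow_ne_top_of_nonneg (by norm_num) (measure_ne_top _ _))
  · simpa using h

/-! ### The homogeneous equation on one edge -/

/-- The solution of `u'' = κ² u` on an edge with the boundary values `p` and `q`. -/
def edgeSol (ℓ κ : ℝ) (p q : ℂ) (x : ℝ) : ℂ :=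
  p * ((Real.sinh (κ * (ℓ - x)) / Real.sinh (κ * ℓ) : ℝ) : ℂ) +
    q * ((Real.sinh (κ * x) / Real.sinh (κ * ℓ) : ℝ) : ℂ)

/-- The derivative of `edgeSol`. -/
def edgeSolDeriv (ℓ κ : ℝ) (p q : ℂ) (x : ℝ) : ℂ :=
  p * ((-κ * Real.cosh (κ * (ℓ - x)) / Real.sinh (κ * ℓ) : ℝ) : ℂ) +
    q * ((κ * Real.cosh (κ * x) / Real.sinh (κ * ℓ) : ℝ) : ℂ)

theorem hasDerivAt_edgeSol (ℓ κ : ℝ) (p q : ℂ) (x : ℝ) :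
    HasDerivAt (edgeSol ℓ κ p q) (edgeSolDeriv ℓ κ p q x) x := by
  have h1 : HasDerivAt (fun x => Real.sinh (κ * (ℓ - x)) / Real.sinh (κ * ℓ))
      (-κ * Real.cosh (κ * (ℓ - x)) / Real.sinh (κ * ℓ)) x := by
    refine (((((hasDerivAt_id' x).const_sub ℓ).const_mul κ).sinh.div_const
      (Real.sinh (κ * ℓ)))).congr_deriv ?_
    ring
  have h2 : HasDerivAt (fun x => Real.sinh (κ * x) / Real.sinh (κ * ℓ))
      (κ * Real.cosh (κ * x) / Real.sinh (κ * ℓ)) x := by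
    refine ((((hasDerivAt_id' x).const_mul κ).sinh.div_const (Real.sinh (κ * ℓ)))).congr_deriv ?_
    ring
  exact (h1.ofReal_comp.const_mul p).add (h2.ofReal_comp.const_mul q)

theorem hasDerivAt_edgeSolDeriv (ℓ κ : ℝ) (p q : ℂ) (x : ℝ) :
    HasDerivAt (edgeSolDeriv ℓ κ p q) ((κ : ℂ) ^ 2 * edgeSol ℓ κ p q x) x := by
  have h1 : HasDerivAt (fun x => -κ * Real.cosh (κ * (ℓ - x)) / Real.sinh (κ * ℓ))
      (κ ^ 2 * (Real.sinh (κ * (ℓ - x)) / Real.sinh (κ * ℓ))) x := by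
    refine ((((((hasDerivAt_id' x).const_sub ℓ).const_mul κ).cosh.const_mul (-κ)).div_const
      (Real.sinh (κ * ℓ)))).congr_deriv ?_
    ring
  have h2 : HasDerivAt (fun x => κ * Real.cosh (κ * x) / Real.sinh (κ * ℓ))
      (κ ^ 2 * (Real.sinh (κ * x) / Real.sinh (κ * ℓ))) x := by
    refine (((((hasDerivAt_id' x).const_mul κ).cosh.const_mul κ).div_const
      (Real.sinh (κ * ℓ)))).congr_deriv ?_
    ring
  refine ((h1.ofReal_comp.const_mul p).add (h2.ofReal_comp.const_mul q)).congr_deriv ?_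
  simp only [edgeSol]; push_cast; ring

theorem continuous_edgeSol (ℓ κ : ℝ) (p q : ℂ) : Continuous (edgeSol ℓ κ p q) :=
  continuous_iff_continuousAt.2 fun x => (hasDerivAt_edgeSol ℓ κ p q x).continuousAt

/-- A criterion for solutions of `-u'' + κ² u = f`. -/
theorem IsSobolevRep.of_integral {ℓ κ : ℝ} {u v : ℝ → ℂ} (hu : Continuous u) (f : EdgeL2 ℓ)
    (huv : ∀ x, HasDerivAt u (v x) x)
    (hv : ∀ x ∈ Icc 0 ℓ, v x = v 0 + (κ : ℂ) ^ 2 * (∫ t in (0 : ℝ)..x, u t)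
      - ∫ t in (0 : ℝ)..x, f t) :
    IsSobolevRep ℓ (ofContinuous ℓ u hu) ((κ : ℂ) ^ 2 • ofContinuous ℓ u hu - f) u v where
  ae_eq := coeFn_ofContinuous hu
  hasDeriv x _ := (huv x).hasDerivWithinAt
  deriv_eq x hx := by
    have h : (((κ : ℂ) ^ 2 • ofContinuous ℓ u hu - f : EdgeL2 ℓ) : ℝ → ℂ) =ᵐ[edgeMeasure ℓ]
        fun t => (κ : ℂ) ^ 2 * u t - f t := by
      filter_upwards [Lp.coeFn_sub ((κ : ℂ) ^ 2 • ofContinuous ℓ u hu) f,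
        Lp.coeFn_smul ((κ : ℂ) ^ 2) (ofContinuous ℓ u hu), coeFn_ofContinuous (ℓ := ℓ) hu]
        with t h1 h2 h3
      rw [h1, Pi.sub_apply, h2, Pi.smul_apply, h3, smul_eq_mul]
    rw [EdgeL2.integral_congr h hx, hv x hx, intervalIntegral.integral_sub
      ((hu.const_mul _).intervalIntegrable _ _) (f.intervalIntegrable hx),
      intervalIntegral.integral_const_mul]
    ring

theorem edgeSol_rep (ℓ κ : ℝ) (p q : ℂ) :
    IsSobolevRep ℓ (ofContinuous ℓ (edgeSol ℓ κ p q) (continuous_edgeSol ℓ κ p q))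
      ((κ : ℂ) ^ 2 • ofContinuous ℓ (edgeSol ℓ κ p q) (continuous_edgeSol ℓ κ p q))
      (edgeSol ℓ κ p q) (edgeSolDeriv ℓ κ p q) := by
  have := IsSobolevRep.of_integral (ℓ := ℓ) (κ := κ) (continuous_edgeSol ℓ κ p q) 0
    (hasDerivAt_edgeSol ℓ κ p q) (fun x hx => by
      rw [EdgeL2.integral_congr (Lp.coeFn_zero _ _ _) hx, ← intervalIntegral.integral_const_mul,
        intervalIntegral.integral_eq_sub_of_hasDerivAt
          (fun y _ => hasDerivAt_edgeSolDeriv ℓ κ p q y)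
          (((continuous_edgeSol ℓ κ p q).const_mul _).intervalIntegrable _ _)]
      simp)
  rwa [sub_zero] at this

theorem edgeSol_left {ℓ κ : ℝ} (hS : Real.sinh (κ * ℓ) ≠ 0) (p q : ℂ) :
    edgeSol ℓ κ p q 0 = p := by
  simp [edgeSol, div_self hS]

theorem edgeSol_right {ℓ κ : ℝ} (hS : Real.sinh (κ * ℓ) ≠ 0) (p q : ℂ) :
    edgeSol ℓ κ p q ℓ = q := by
  simp [edgeSol, div_self hS]

/-- Reversing the edge swaps the end values, so evenness of an eigenfunction can be read off from
its vertex values. -/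
theorem edgeSol_reflect (ℓ κ : ℝ) (p q : ℂ) (x : ℝ) :
    edgeSol ℓ κ q p (ℓ - x) = edgeSol ℓ κ p q x := by
  simp only [edgeSol, sub_sub_cancel]; ring

/-- The `C¹` representative of a Sobolev function vanishes if the function does. -/
theorem IsSobolevRep.rep_eq_zero {ℓ : ℝ} (hℓ : 0 < ℓ) {g : EdgeL2 ℓ} {u v : ℝ → ℂ}
    (h : IsSobolevRep ℓ 0 g u v) : ∀ x ∈ Icc 0 ℓ, u x = 0 := by
  have hc : ContinuousOn u (Icc 0 ℓ) := fun x hx => (h.hasDeriv x hx).continuousWithinAt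
  have hae : u =ᵐ[volume.restrict (Icc 0 ℓ)] (fun _ => (0 : ℂ)) := by
    rw [← Measure.restrict_congr_set (Ioc_ae_eq_Icc (a := (0 : ℝ)) (b := ℓ))]
    exact h.ae_eq.symm.trans (Lp.coeFn_zero _ _ _)
  exact Measure.eqOn_Icc_of_ae_eq volume hℓ.ne hae hc continuousOn_const

/-- `edgeSol` as a linear map of the boundary values. -/
def edgeSolMap (ℓ κ : ℝ) : ℂ × ℂ →ₗ[ℂ] EdgeL2 ℓ where
  toFun p := ofContinuous ℓ (edgeSol ℓ κ p.1 p.2) (continuous_edgeSol ℓ κ p.1 p.2)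
  map_add' p q := by
    refine EdgeL2.ext_of_eqOn (coeFn_ofContinuous _) ?_
    filter_upwards [Lp.coeFn_add
        (ofContinuous ℓ (edgeSol ℓ κ p.1 p.2) (continuous_edgeSol ℓ κ p.1 p.2))
        (ofContinuous ℓ (edgeSol ℓ κ q.1 q.2) (continuous_edgeSol ℓ κ q.1 q.2)),
      coeFn_ofContinuous (ℓ := ℓ) (continuous_edgeSol ℓ κ p.1 p.2),
      coeFn_ofContinuous (ℓ := ℓ) (continuous_edgeSol ℓ κ q.1 q.2)] with x h1 h2 h3
    rw [h1, Pi.add_apply, h2, h3]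
    simp only [edgeSol, Prod.fst_add, Prod.snd_add]; ring
  map_smul' c p := by
    refine EdgeL2.ext_of_eqOn (coeFn_ofContinuous _) ?_
    filter_upwards [Lp.coeFn_smul c
        (ofContinuous ℓ (edgeSol ℓ κ p.1 p.2) (continuous_edgeSol ℓ κ p.1 p.2)),
      coeFn_ofContinuous (ℓ := ℓ) (continuous_edgeSol ℓ κ p.1 p.2)] with x h1 h2
    rw [RingHom.id_apply, h1, Pi.smul_apply, h2]
    simp only [edgeSol, Prod.smul_fst, Prod.smul_snd, smul_eq_mul]; ring

theorem edgeSolMap_rep (ℓ κ : ℝ) (p q : ℂ) :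
    IsSobolevRep ℓ (edgeSolMap ℓ κ (p, q)) ((κ : ℂ) ^ 2 • edgeSolMap ℓ κ (p, q))
      (edgeSol ℓ κ p q) (edgeSolDeriv ℓ κ p q) := edgeSol_rep ℓ κ p q

theorem sinh_mul_pos {ℓ κ : ℝ} (hℓ : 0 < ℓ) (hκ : 0 < κ) : 0 < Real.sinh (κ * ℓ) :=
  Real.sinh_pos_iff.2 (mul_pos hκ hℓ)

theorem edgeSolMap_injective {ℓ κ : ℝ} (hℓ : 0 < ℓ) (hκ : 0 < κ) :
    Function.Injective (edgeSolMap ℓ κ) := by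
  refine (injective_iff_map_eq_zero _).2 fun ⟨p, q⟩ h => ?_
  have hr := edgeSolMap_rep ℓ κ p q
  rw [h] at hr
  have hS := (sinh_mul_pos hℓ hκ).ne'
  have h0 := hr.rep_eq_zero hℓ
  have h1 := h0 0 ⟨le_rfl, hℓ.le⟩
  have h2 := h0 ℓ ⟨hℓ.le, le_rfl⟩
  rw [edgeSol_left hS] at h1
  rw [edgeSol_right hS] at h2
  rw [h1, h2, Prod.mk_zero_zero]

theorem exists_norm_edgeSolMap_le (ℓ κ : ℝ) :
    ∃ K, 0 ≤ K ∧ ∀ p q : ℂ, ‖edgeSolMap ℓ κ (p, q)‖ ≤ K * (‖p‖ + ‖q‖) := by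
  refine ⟨‖LinearMap.toContinuousLinearMap (edgeSolMap ℓ κ)‖, norm_nonneg _, fun p q => ?_⟩
  refine ((LinearMap.toContinuousLinearMap (edgeSolMap ℓ κ)).le_opNorm (p, q)).trans ?_
  gcongr
  rw [Prod.norm_def]
  exact max_le (le_add_of_nonneg_right (norm_nonneg _)) (le_add_of_nonneg_left (norm_nonneg _))

/-- An injective linear map on a finite-dimensional space is bounded below. This transfers
square-summability from the edge norms of an eigenfunction to its vertex values. -/
theorem exists_norm_le_edgeSolMap {ℓ κ : ℝ} (hℓ : 0 < ℓ) (hκ : 0 < κ) :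
    ∃ K, 0 ≤ K ∧ ∀ p q : ℂ, ‖p‖ ≤ K * ‖edgeSolMap ℓ κ (p, q)‖ := by
  obtain ⟨K, -, hK⟩ := (edgeSolMap ℓ κ).injective_iff_antilipschitz.1 (edgeSolMap_injective hℓ hκ)
  refine ⟨K, K.2, fun p q => ?_⟩
  have := ZeroHomClass.bound_of_antilipschitz (edgeSolMap ℓ κ) hK (p, q)
  exact (norm_fst_le (p, q)).trans this

/-- Every solution of `u'' = κ² u` on an edge is an `edgeSol`. -/
theorem IsSobolevRep.eq_edgeSol {ℓ κ : ℝ} (hℓ : 0 < ℓ) (hκ : 0 < κ) {ψ : EdgeL2 ℓ}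
    {u v : ℝ → ℂ} (h : IsSobolevRep ℓ ψ ((κ : ℂ) ^ 2 • ψ) u v) :
    ψ = edgeSolMap ℓ κ (u 0, u ℓ) ∧ ∀ x ∈ Icc 0 ℓ, v x = edgeSolDeriv ℓ κ (u 0) (u ℓ) x := by
  have hS := (sinh_mul_pos hℓ hκ).ne'
  -- Subtract the explicit solution with the same end values; the difference `U` vanishes at both
  -- ends and has to be shown to be zero.
  have hr := h.add ((edgeSolMap_rep ℓ κ (u 0) (u ℓ)).smul (-1))
  set ψ' := edgeSolMap ℓ κ (u 0, u ℓ)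
  set U : ℝ → ℂ := u + (-1 : ℂ) • edgeSol ℓ κ (u 0) (u ℓ) with hU
  set V : ℝ → ℂ := v + (-1 : ℂ) • edgeSolDeriv ℓ κ (u 0) (u ℓ) with hV
  have hU0 : U 0 = 0 := by simp [hU, edgeSol_left hS]
  have hUℓ : U ℓ = 0 := by simp [hU, edgeSol_right hS]
  have hUc : ContinuousOn U (Icc 0 ℓ) := fun x hx => (hr.hasDeriv x hx).continuousWithinAt
  have hUV : ∀ x ∈ Icc 0 ℓ, V x = V 0 + ∫ t in (0 : ℝ)..x, (κ : ℂ) ^ 2 * U t := by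
    intro x hx
    rw [hr.deriv_eq x hx]
    congr 1
    refine EdgeL2.integral_congr ?_ hx
    have he : (κ : ℂ) ^ 2 • ψ + (-1 : ℂ) • (κ : ℂ) ^ 2 • ψ' = (κ : ℂ) ^ 2 • (ψ + (-1 : ℂ) • ψ') := by
      rw [smul_add, smul_comm]
    rw [he]
    filter_upwards [Lp.coeFn_smul ((κ : ℂ) ^ 2) (ψ + (-1 : ℂ) • ψ'), hr.ae_eq] with t h1 h2
    rw [h1, Pi.smul_apply, h2, smul_eq_mul]
  have hVd : ∀ x ∈ Icc 0 ℓ, HasDerivWithinAt V ((κ : ℂ) ^ 2 * U x) (Icc 0 ℓ) x := by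
    intro x hx
    have hc : ContinuousOn (fun t => (κ : ℂ) ^ 2 * U t) (Icc 0 ℓ) := hUc.const_mul _
    have : Fact (x ∈ Icc 0 ℓ) := ⟨hx⟩
    have hi : IntervalIntegrable (fun t => (κ : ℂ) ^ 2 * U t) volume 0 x :=
      (hc.mono (by rw [uIcc_of_le hx.1]; exact Icc_subset_Icc_right hx.2)).intervalIntegrable
    have := intervalIntegral.integral_hasDerivWithinAt_right (s := Icc 0 ℓ) (t := Icc 0 ℓ) hi
      (hc.stronglyMeasurableAtFilter_nhdsWithin measurableSet_Icc x) (hc x hx)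
    exact (this.const_add (V 0)).congr hUV (hUV x hx)
  have hcosh : ∀ x : ℝ, HasDerivAt (fun x => ((Real.cosh (κ * x) : ℝ) : ℂ))
      ((κ * Real.sinh (κ * x) : ℝ) : ℂ) x := fun x => by
    refine HasDerivAt.ofReal_comp ?_
    refine ((hasDerivAt_id' x).const_mul κ).cosh.congr_deriv ?_
    ring
  have hsinh : ∀ x : ℝ, HasDerivAt (fun x => ((Real.sinh (κ * x) : ℝ) : ℂ))
      ((κ * Real.cosh (κ * x) : ℝ) : ℂ) x := fun x => by
    refine HasDerivAt.ofReal_comp ?_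
    refine ((hasDerivAt_id' x).const_mul κ).sinh.congr_deriv ?_
    ring
  have const : ∀ W : ℝ → ℂ, (∀ x ∈ Icc 0 ℓ, HasDerivWithinAt W 0 (Icc 0 ℓ) x) →
      ∀ x ∈ Icc 0 ℓ, W x = W 0 := fun W hW x hx =>
    constant_of_derivWithin_zero (fun y hy => (hW y hy).differentiableWithinAt)
      (fun y hy => (hW y (Ico_subset_Icc_self hy)).derivWithin
        (uniqueDiffOn_Icc hℓ y (Ico_subset_Icc_self hy))) x hx
  -- Two first integrals of $U''=\kappa^2U$. Together with $U(0)=U(\ell)=0$ they force $V(\ell)=0$,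
  -- then $V(0)=0$; both constants are then zero, and $\cosh^2-\sinh^2=1$ gives $U=V=0$ everywhere.
  have c1 := const (fun x => V x * ((Real.cosh (κ * x) : ℝ) : ℂ)
      - κ * U x * ((Real.sinh (κ * x) : ℝ) : ℂ)) (fun x hx => by
    refine (((hVd x hx).mul (hcosh x).hasDerivWithinAt).sub
      (((hr.hasDeriv x hx).const_mul (κ : ℂ)).mul (hsinh x).hasDerivWithinAt)).congr_deriv ?_
    push_cast
    ring)
  have c2 := const (fun x => κ * U x * ((Real.cosh (κ * x) : ℝ) : ℂ)
      - V x * ((Real.sinh (κ * x) : ℝ) : ℂ)) (fun x hx => by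
    refine ((((hr.hasDeriv x hx).const_mul (κ : ℂ)).mul (hcosh x).hasDerivWithinAt).sub
      ((hVd x hx).mul (hsinh x).hasDerivWithinAt)).congr_deriv ?_
    push_cast
    ring)
  simp only [mul_zero, Real.cosh_zero, Real.sinh_zero, Complex.ofReal_one, Complex.ofReal_zero,
    mul_one, sub_zero, hU0] at c1 c2
  have hcs : ∀ x : ℝ, ((Real.cosh (κ * x) : ℝ) : ℂ) ^ 2 - ((Real.sinh (κ * x) : ℝ) : ℂ) ^ 2 = 1 :=
    fun x => by exact_mod_cast Real.cosh_sq_sub_sinh_sq (κ * x)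
  have hV0 : V 0 = 0 := by
    have h1 := c1 ℓ ⟨hℓ.le, le_rfl⟩
    have h2 := c2 ℓ ⟨hℓ.le, le_rfl⟩
    rw [hUℓ] at h1 h2
    have h3 : V ℓ = 0 := by
      have : V ℓ * ((Real.sinh (κ * ℓ) : ℝ) : ℂ) = 0 := by linear_combination -h2
      exact (mul_eq_zero.1 this).resolve_right (by exact_mod_cast hS)
    rw [← h1, h3]; ring
  have hz : ∀ x ∈ Icc 0 ℓ, U x = 0 ∧ V x = 0 := by
    intro x hx
    have h1 := c1 x hx
    have h2 := c2 x hx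
    rw [hV0] at h1
    constructor
    · have : (κ : ℂ) * U x = 0 := by
        linear_combination ((Real.sinh (κ * x) : ℝ) : ℂ) * h1 + ((Real.cosh (κ * x) : ℝ) : ℂ) * h2
          - κ * U x * hcs x
      exact (mul_eq_zero.1 this).resolve_left (by exact_mod_cast hκ.ne')
    · linear_combination ((Real.sinh (κ * x) : ℝ) : ℂ) * h2 + ((Real.cosh (κ * x) : ℝ) : ℂ) * h1
          - V x * hcs x
  refine ⟨?_, fun x hx => ?_⟩
  · have h0 : ψ + (-1 : ℂ) • ψ' = 0 := by
      refine Lp.ext ((hr.ae_eq.trans ?_).trans (Lp.coeFn_zero _ _ _).symm)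
      exact ae_edgeMeasure_of_forall fun x hx => (hz x hx).1
    rw [neg_one_smul, ← sub_eq_add_neg] at h0
    exact sub_eq_zero.1 h0
  · have := (hz x hx).2
    simp only [hV, Pi.add_apply, Pi.neg_apply, neg_smul, one_smul] at this
    linear_combination this

theorem edgeSolDeriv_left (ℓ κ : ℝ) (p q : ℂ) :
    edgeSolDeriv ℓ κ p q 0 =
      ((κ / Real.sinh (κ * ℓ) : ℝ) : ℂ) * (q - ((Real.cosh (κ * ℓ) : ℝ) : ℂ) * p) := by
  simp only [edgeSolDeriv, sub_zero, mul_zero, Real.cosh_zero]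
  push_cast; ring

theorem edgeSolDeriv_right (ℓ κ : ℝ) (p q : ℂ) :
    edgeSolDeriv ℓ κ p q ℓ =
      ((κ / Real.sinh (κ * ℓ) : ℝ) : ℂ) * (((Real.cosh (κ * ℓ) : ℝ) : ℂ) * q - p) := by
  simp only [edgeSolDeriv, sub_self, mul_zero, Real.cosh_zero]
  push_cast; ring

/-! ### The inhomogeneous equation on one edge -/

/-- Solution of `-u'' + κ² u = f` with vanishing initial data, with bounds on `u` and on `u'`. -/
theorem exists_initial_sol {ℓ κ : ℝ} (hℓ : 0 < ℓ) (hκ : 0 < κ) :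
    ∃ K, 0 ≤ K ∧ ∀ f : EdgeL2 ℓ, ∃ (ψ : EdgeL2 ℓ) (u v : ℝ → ℂ),
      IsSobolevRep ℓ ψ ((κ : ℂ) ^ 2 • ψ - f) u v ∧ u 0 = 0 ∧ v 0 = 0 ∧
      ‖u ℓ‖ ≤ K * ‖f‖ ∧ ‖v ℓ‖ ≤ K * ‖f‖ ∧ ‖ψ‖ ≤ K * ‖f‖ := by
  set c : ℝ := ((edgeMeasure ℓ univ) ^ (1 - 1 / 2 : ℝ)).toReal with hc
  set m : ℝ := (measureUnivNNReal (edgeMeasure ℓ) : ℝ) ^ (1 / 2 : ℝ) with hm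
  set D : ℝ := Real.cosh (κ * ℓ) with hD
  have hc0 : 0 ≤ c := ENNReal.toReal_nonneg
  have hm0 : 0 ≤ m := by positivity
  have hD1 : 1 ≤ D := Real.one_le_cosh _
  set M : ℝ := 2 * D * (D * c * ℓ) with hM
  have hM0 : 0 ≤ M := by positivity
  have hcoshD : ∀ t ∈ Icc 0 ℓ, Real.cosh (κ * t) ≤ D := fun t ht => by
    refine Real.cosh_le_cosh.2 ?_
    rw [abs_of_nonneg (mul_nonneg hκ.le ht.1), abs_of_nonneg (mul_nonneg hκ.le hℓ.le)]
    exact mul_le_mul_of_nonneg_left ht.2 hκ.le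
  have hsinhD : ∀ t ∈ Icc 0 ℓ, |Real.sinh (κ * t)| ≤ D := fun t ht => by
    rw [abs_of_nonneg (Real.sinh_nonneg_iff.2 (mul_nonneg hκ.le ht.1))]
    exact (Real.sinh_lt_cosh _).le.trans (hcoshD t ht)
  refine ⟨M + (κ * M + c) + m * M, by positivity, fun f => ?_⟩
  set F : ℝ → ℂ := (Ioc 0 ℓ).indicator f with hF
  have hFint : Integrable F volume :=
    (integrable_indicator_iff measurableSet_Ioc).2 ((Lp.memLp f).integrable (by norm_num))
  -- Variation of constants is applied to the continuous primitive `G` instead of the merely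
  -- square-integrable `f`. One solves $U''=\kappa^2U-G$ by
  -- $U(x)=-\kappa^{-1}\int_0^x\sinh(\kappa(x-t))\,G(t)\,dt$ and takes $u=U'$, so that
  -- $v=u'=\kappa^2U-G$ is already in the integrated form required by `IsSobolevRep.of_integral`.
  set G : ℝ → ℂ := fun x => ∫ t in (0 : ℝ)..x, F t with hG
  have hGc : Continuous G := intervalIntegral.continuous_primitive
    (fun a b => hFint.intervalIntegrable) 0
  have hGf : ∀ x ∈ Icc 0 ℓ, G x = ∫ t in (0 : ℝ)..x, f t := fun x hx => by
    refine EdgeL2.integral_congr ?_ hx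
    exact (ae_restrict_iff' measurableSet_Ioc).2 (ae_of_all _ fun t ht => indicator_of_mem ht f)
  have hGb : ∀ x ∈ Icc 0 ℓ, ‖G x‖ ≤ c * ‖f‖ := fun x hx => by
    rw [hGf x hx]
    refine (intervalIntegral.norm_integral_le_integral_norm hx.1).trans
      (le_trans ?_ f.integral_norm_le)
    rw [intervalIntegral.integral_of_le hx.1]
    exact setIntegral_mono_set ((Lp.memLp f).integrable (by norm_num)).norm
      (ae_of_all _ fun _ => norm_nonneg _) (Ioc_subset_Ioc_right hx.2).eventuallyLE
  have hcc : Continuous fun x : ℝ => ((Real.cosh (κ * x) : ℝ) : ℂ) :=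
    Complex.continuous_ofReal.comp (Real.continuous_cosh.comp (continuous_const.mul continuous_id))
  have hsc : Continuous fun x : ℝ => ((Real.sinh (κ * x) : ℝ) : ℂ) :=
    Complex.continuous_ofReal.comp (Real.continuous_sinh.comp (continuous_const.mul continuous_id))
  have hcosh : ∀ x : ℝ, HasDerivAt (fun x => ((Real.cosh (κ * x) : ℝ) : ℂ))
      ((κ * Real.sinh (κ * x) : ℝ) : ℂ) x := fun x => by
    refine HasDerivAt.ofReal_comp ?_
    refine ((hasDerivAt_id' x).const_mul κ).cosh.congr_deriv ?_
    ring
  have hsinh : ∀ x : ℝ, HasDerivAt (fun x => ((Real.sinh (κ * x) : ℝ) : ℂ))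
      ((κ * Real.cosh (κ * x) : ℝ) : ℂ) x := fun x => by
    refine HasDerivAt.ofReal_comp ?_
    refine ((hasDerivAt_id' x).const_mul κ).sinh.congr_deriv ?_
    ring
  set A : ℝ → ℂ := fun x => ∫ t in (0 : ℝ)..x, ((Real.cosh (κ * t) : ℝ) : ℂ) * G t with hA
  set B : ℝ → ℂ := fun x => ∫ t in (0 : ℝ)..x, ((Real.sinh (κ * t) : ℝ) : ℂ) * G t with hB
  have hA' : ∀ x, HasDerivAt A (((Real.cosh (κ * x) : ℝ) : ℂ) * G x) x := fun x =>
    (hcc.mul hGc).integral_hasStrictDerivAt 0 x |>.hasDerivAt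
  have hB' : ∀ x, HasDerivAt B (((Real.sinh (κ * x) : ℝ) : ℂ) * G x) x := fun x =>
    (hsc.mul hGc).integral_hasStrictDerivAt 0 x |>.hasDerivAt
  have hAb : ∀ x ∈ Icc 0 ℓ, ‖A x‖ ≤ D * c * ℓ * ‖f‖ := fun x hx => by
    refine (intervalIntegral.norm_integral_le_of_norm_le_const (C := D * (c * ‖f‖)) ?_).trans ?_
    · intro t ht
      rw [uIoc_of_le hx.1] at ht
      have ht' : t ∈ Icc 0 ℓ := ⟨ht.1.le, ht.2.trans hx.2⟩
      rw [norm_mul, Complex.norm_real, Real.norm_eq_abs, abs_of_pos (Real.cosh_pos _)]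
      exact mul_le_mul (hcoshD t ht') (hGb t ht') (norm_nonneg _) (by positivity)
    · rw [sub_zero, abs_of_nonneg hx.1]
      calc D * (c * ‖f‖) * x ≤ D * (c * ‖f‖) * ℓ := by gcongr; exact hx.2
        _ = D * c * ℓ * ‖f‖ := by ring
  have hBb : ∀ x ∈ Icc 0 ℓ, ‖B x‖ ≤ D * c * ℓ * ‖f‖ := fun x hx => by
    refine (intervalIntegral.norm_integral_le_of_norm_le_const (C := D * (c * ‖f‖)) ?_).trans ?_
    · intro t ht
      rw [uIoc_of_le hx.1] at ht
      have ht' : t ∈ Icc 0 ℓ := ⟨ht.1.le, ht.2.trans hx.2⟩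
      rw [norm_mul, Complex.norm_real, Real.norm_eq_abs]
      exact mul_le_mul (hsinhD t ht') (hGb t ht') (norm_nonneg _) (by positivity)
    · rw [sub_zero, abs_of_nonneg hx.1]
      calc D * (c * ‖f‖) * x ≤ D * (c * ‖f‖) * ℓ := by gcongr; exact hx.2
        _ = D * c * ℓ * ‖f‖ := by ring
  have hcs : ∀ x : ℝ, ((Real.cosh (κ * x) : ℝ) : ℂ) ^ 2 - ((Real.sinh (κ * x) : ℝ) : ℂ) ^ 2 = 1 :=
    fun x => by exact_mod_cast Real.cosh_sq_sub_sinh_sq (κ * x)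
  have comb : ∀ x ∈ Icc 0 ℓ, ∀ a b : ℝ, |a| ≤ D → |b| ≤ D →
      ‖(a : ℂ) * A x - (b : ℂ) * B x‖ ≤ M * ‖f‖ := fun x hx a b ha hb => by
    refine (norm_sub_le _ _).trans ?_
    rw [norm_mul, norm_mul, Complex.norm_real, Complex.norm_real, Real.norm_eq_abs,
      Real.norm_eq_abs]
    have h1 := mul_le_mul ha (hAb x hx) (norm_nonneg _) (by positivity)
    have h2 := mul_le_mul hb (hBb x hx) (norm_nonneg _) (by positivity)
    rw [hM]
    linarith
  have hD' : ∀ t ∈ Icc 0 ℓ, |Real.cosh (κ * t)| ≤ D := fun t ht => by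
    rw [abs_of_pos (Real.cosh_pos _)]; exact hcoshD t ht
  set U : ℝ → ℂ := fun x => -(κ : ℂ)⁻¹ *
    (((Real.sinh (κ * x) : ℝ) : ℂ) * A x - ((Real.cosh (κ * x) : ℝ) : ℂ) * B x) with hU
  set u : ℝ → ℂ := fun x =>
    -(((Real.cosh (κ * x) : ℝ) : ℂ) * A x - ((Real.sinh (κ * x) : ℝ) : ℂ) * B x) with hu
  set v : ℝ → ℂ := fun x => (κ : ℂ) ^ 2 * U x - G x with hv
  have hκ' : (κ : ℂ) ≠ 0 := by exact_mod_cast hκ.ne'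
  have hU' : ∀ x, HasDerivAt U (u x) x := fun x => by
    refine ((((hsinh x).mul (hA' x)).sub ((hcosh x).mul (hB' x))).const_mul
      (-(κ : ℂ)⁻¹)).congr_deriv ?_
    simp only [hu]
    push_cast
    field_simp
    ring
  have hu' : ∀ x, HasDerivAt u (v x) x := fun x => by
    refine (((hcosh x).mul (hA' x)).sub ((hsinh x).mul (hB' x))).neg.congr_deriv ?_
    simp only [hv, hU]
    have hc := hcs x
    push_cast at hc ⊢
    field_simp
    linear_combination (-G x) * hc
  have huc : Continuous u := continuous_iff_continuousAt.2 fun x => (hu' x).continuousAt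
  have hG0 : G 0 = 0 := by simp [hG]
  have hA0 : A 0 = 0 := by simp [hA]
  have hB0 : B 0 = 0 := by simp [hB]
  have hU0 : U 0 = 0 := by simp [hU, hA0, hB0]
  have hv0 : v 0 = 0 := by simp [hv, hU0, hG0]
  have hub : ∀ x ∈ Icc 0 ℓ, ‖u x‖ ≤ M * ‖f‖ := fun x hx => by
    simp only [hu, norm_neg]
    exact comb x hx _ _ (hD' x hx) (hsinhD x hx)
  have hℓm : ℓ ∈ Icc 0 ℓ := ⟨hℓ.le, le_rfl⟩
  refine ⟨ofContinuous ℓ u huc, u, v, IsSobolevRep.of_integral huc f hu' ?_, ?_, hv0, ?_, ?_, ?_⟩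
  · intro x hx
    rw [intervalIntegral.integral_eq_sub_of_hasDerivAt (fun y _ => hU' y)
      (huc.intervalIntegrable _ _), ← hGf x hx, hv0, hU0]
    simp only [hv]
    ring
  · simp [hu, hA0, hB0]
  · refine (hub ℓ hℓm).trans (mul_le_mul_of_nonneg_right ?_ (norm_nonneg _))
    have : 0 ≤ κ * M + c + m * M := by positivity
    linarith
  · have h1 : ‖v ℓ‖ ≤ κ * (M * ‖f‖) + c * ‖f‖ := by
      have he : v ℓ = -((κ : ℂ) * (((Real.sinh (κ * ℓ) : ℝ) : ℂ) * A ℓ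
          - ((Real.cosh (κ * ℓ) : ℝ) : ℂ) * B ℓ)) - G ℓ := by
        simp only [hv, hU]
        field_simp
      rw [he]
      refine (norm_sub_le _ _).trans (add_le_add ?_ (hGb ℓ hℓm))
      rw [norm_neg, norm_mul, Complex.norm_real, Real.norm_eq_abs, abs_of_pos hκ]
      exact mul_le_mul_of_nonneg_left (comb ℓ hℓm _ _ (hsinhD ℓ hℓm) (hD' ℓ hℓm)) hκ.le
    refine h1.trans ?_
    have : 0 ≤ (M + m * M) * ‖f‖ := by positivity
    linarith
  · refine (norm_ofContinuous_le huc (by positivity) hub).trans ?_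
    have : 0 ≤ (M + (κ * M + c)) * ‖f‖ := by positivity
    rw [← hm]
    linarith

/-- Solution of `-u'' + κ² u = f` on an edge with prescribed boundary values; the boundary
derivatives differ from those of `edgeSol` by quantities depending boundedly on `f` alone. -/
theorem exists_edge_sol {ℓ κ : ℝ} (hℓ : 0 < ℓ) (hκ : 0 < κ) :
    ∃ K, 0 ≤ K ∧ ∀ f : EdgeL2 ℓ, ∃ a b : ℂ, ‖a‖ ≤ K * ‖f‖ ∧ ‖b‖ ≤ K * ‖f‖ ∧
      ∀ p q : ℂ, ∃ (ψ : EdgeL2 ℓ) (u v : ℝ → ℂ),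
        IsSobolevRep ℓ ψ ((κ : ℂ) ^ 2 • ψ - f) u v ∧ u 0 = p ∧ u ℓ = q ∧
        v 0 = edgeSolDeriv ℓ κ p q 0 + a ∧ v ℓ = edgeSolDeriv ℓ κ p q ℓ + b ∧
        ‖ψ‖ ≤ K * (‖p‖ + ‖q‖ + ‖f‖) := by
  obtain ⟨K, hK, h⟩ := exists_initial_sol hℓ hκ
  obtain ⟨N, hN, hN'⟩ := exists_norm_edgeSolMap_le ℓ κ
  have hS := (sinh_mul_pos hℓ hκ).ne'
  have hlin : ∀ p q r x, edgeSolDeriv ℓ κ p (q - r) x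
      = edgeSolDeriv ℓ κ p q x - r * edgeSolDeriv ℓ κ 0 1 x := fun p q r x => by
    simp only [edgeSolDeriv]; ring
  set d := ‖edgeSolDeriv ℓ κ 0 1 0‖ with hd
  set e := ‖edgeSolDeriv ℓ κ 0 1 ℓ‖ with he
  refine ⟨K * d + (K + K * e) + (N + K + N * K), by positivity, fun f => ?_⟩
  obtain ⟨ψ, u, v, hr, hu0, hv0, huℓ, hvℓ, hψ⟩ := h f
  -- The solution with zero initial data ends at `u ℓ`, so the homogeneous solution with end values
  -- `p` and `q - u ℓ` is added. By linearity the resulting derivative offsets do not involve `p` or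
  -- `q`.
  refine ⟨-(u ℓ * edgeSolDeriv ℓ κ 0 1 0), v ℓ - u ℓ * edgeSolDeriv ℓ κ 0 1 ℓ, ?_, ?_,
    fun p q => ?_⟩
  · rw [norm_neg, norm_mul]
    have h1 : ‖u ℓ‖ * d ≤ K * ‖f‖ * d := by gcongr
    have : 0 ≤ ((K + K * e) + (N + K + N * K)) * ‖f‖ := by positivity
    linarith
  · refine (norm_sub_le _ _).trans ?_
    rw [norm_mul]
    have h1 : ‖u ℓ‖ * e ≤ K * ‖f‖ * e := by gcongr
    have : 0 ≤ (K * d + (N + K + N * K)) * ‖f‖ := by positivity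
    linarith
  · refine ⟨ψ + edgeSolMap ℓ κ (p, q - u ℓ), u + edgeSol ℓ κ p (q - u ℓ),
      v + edgeSolDeriv ℓ κ p (q - u ℓ), ?_, ?_, ?_, ?_, ?_, ?_⟩
    · have := hr.add (edgeSolMap_rep ℓ κ p (q - u ℓ))
      convert this using 1
      rw [smul_add]; abel
    · simp [hu0, edgeSol_left hS]
    · simp [edgeSol_right hS]
    · simp only [Pi.add_apply, hv0, hlin]; ring
    · simp only [Pi.add_apply, hlin]; ring
    · have h1 := hN' p (q - u ℓ)
      have h2 := norm_sub_le q (u ℓ)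
      have h3 : N * ‖q - u ℓ‖ ≤ N * (‖q‖ + K * ‖f‖) := by gcongr; linarith
      refine (norm_add_le _ _).trans ?_
      have h4 : 0 ≤ (K * d + (K + K * e) + (K + N * K)) * (‖p‖ + ‖q‖) := by positivity
      have h5 : 0 ≤ (K * d + (K + K * e) + N) * ‖f‖ := by positivity
      linarith

/-! ### Square-summable families with explicit bounds -/

/-- The squares of the family `a` have partial sums bounded by `B`. -/
def SqSumLE {ι : Type*} (a : ι → ℝ) (B : ℝ) : Prop := ∀ s : Finset ι, ∑ i ∈ s, a i ^ 2 ≤ B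

section SqSum

variable {ι ι' : Type*} {a b : ι → ℝ} {A B : ℝ}

theorem SqSumLE.summable (h : SqSumLE a A) : Summable fun i => a i ^ 2 :=
  summable_of_sum_le (fun _ => sq_nonneg _) h

theorem SqSumLE.mono (h : SqSumLE a A) (hb : ∀ i, 0 ≤ b i) (hab : ∀ i, b i ≤ a i) :
    SqSumLE b A := fun s =>
  (Finset.sum_le_sum fun i _ => pow_le_pow_left₀ (hb i) (hab i) 2).trans (h s)

theorem SqSumLE.add (ha : SqSumLE a A) (hb : SqSumLE b B) :
    SqSumLE (fun i => a i + b i) (2 * A + 2 * B) := fun s => by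
  calc ∑ i ∈ s, (a i + b i) ^ 2 ≤ ∑ i ∈ s, (2 * a i ^ 2 + 2 * b i ^ 2) :=
        Finset.sum_le_sum fun i _ => by nlinarith [sq_nonneg (a i - b i)]
    _ = 2 * ∑ i ∈ s, a i ^ 2 + 2 * ∑ i ∈ s, b i ^ 2 := by
        rw [Finset.sum_add_distrib, Finset.mul_sum, Finset.mul_sum]
    _ ≤ 2 * A + 2 * B := by linarith [ha s, hb s]

theorem SqSumLE.const_mul (ha : SqSumLE a A) (c : ℝ) :
    SqSumLE (fun i => c * a i) (c ^ 2 * A) := fun s => by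
  simp only [mul_pow, ← Finset.mul_sum]
  exact mul_le_mul_of_nonneg_left (ha s) (sq_nonneg c)

theorem SqSumLE.comp_injective (ha : SqSumLE a A) {σ : ι' → ι} (hσ : Function.Injective σ) :
    SqSumLE (fun i => a (σ i)) A := fun s => by
  have := ha (s.map ⟨σ, hσ⟩)
  rwa [Finset.sum_map] at this

theorem SqSumLE.comp_fst (ha : SqSumLE a A) :
    SqSumLE (fun e : ι × Bool => a e.1) (2 * A) := fun s => by
  classical
  calc ∑ e ∈ s, a e.1 ^ 2 ≤ ∑ e ∈ s.image Prod.fst ×ˢ Finset.univ, a e.1 ^ 2 :=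
        Finset.sum_le_sum_of_subset_of_nonneg
          (fun e he => Finset.mem_product.2 ⟨Finset.mem_image_of_mem _ he, Finset.mem_univ _⟩)
          fun _ _ _ => sq_nonneg _
    _ = 2 * ∑ i ∈ s.image Prod.fst, a i ^ 2 := by
        rw [Finset.sum_product, Finset.mul_sum]
        simp
    _ ≤ 2 * A := by linarith [ha (s.image Prod.fst)]

variable {E : ι → Type*} [∀ i, NormedAddCommGroup (E i)]

theorem sqSumLE_lp (x : lp E 2) : SqSumLE (fun i => ‖x i‖) (‖x‖ ^ 2) := fun s => by
  have := lp.sum_rpow_le_norm_rpow (p := 2) (by norm_num) x s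
  simpa using this

theorem SqSumLE.memℓp {x : ∀ i, E i} (h : SqSumLE (fun i => ‖x i‖) A) : Memℓp x 2 :=
  memℓp_gen' (C := A) fun s => by simpa using h s

theorem SqSumLE.norm_le {x : lp E 2} (h : SqSumLE (fun i => ‖x i‖) (A ^ 2)) (hA : 0 ≤ A) :
    ‖x‖ ≤ A :=
  lp.norm_le_of_forall_sum_le (p := 2) (by norm_num) hA fun s => by simpa using h s

end SqSum

/-! ### Maximum principle and absence of eigenvalues -/

/-- A discrete maximum principle. -/
theorem eq_zero_of_subharmonic {p : ℤ → ℂ} (hp : Summable fun j => ‖p j‖ ^ 2)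
    (h : ∀ j, ∃ a b c : ℝ, 0 ≤ a ∧ 0 ≤ b ∧ a + b < c ∧
      (c : ℂ) * p j = a * p (j + 1) + b * p (j - 1)) (j : ℤ) : p j = 0 := by
  by_contra hj
  have hpos : 0 < ‖p j‖ ^ 2 := by positivity
  -- Square-summability makes `‖p i‖` tend to zero, so a nonzero value leaves only finitely many
  -- competitors and the maximum is attained.
  have hfin : {i | ‖p j‖ ^ 2 ≤ ‖p i‖ ^ 2}.Finite := by
    have := hp.tendsto_cofinite_zero.eventually (gt_mem_nhds hpos)
    rw [Filter.eventually_cofinite] at this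
    simpa only [not_lt] using this
  obtain ⟨m, hm, hmax⟩ := Set.exists_max_image _ (fun i => ‖p i‖) hfin
    ⟨j, le_refl (‖p j‖ ^ 2)⟩
  have hpm : ‖p j‖ ≤ ‖p m‖ := (pow_le_pow_iff_left₀ (norm_nonneg _) (norm_nonneg _) two_ne_zero).1 hm
  have hle : ∀ i, ‖p i‖ ≤ ‖p m‖ := fun i => by
    rcases le_total (‖p j‖ ^ 2) (‖p i‖ ^ 2) with hi | hi
    · exact hmax i hi
    · exact ((pow_le_pow_iff_left₀ (norm_nonneg _) (norm_nonneg _) two_ne_zero).1 hi).trans hpm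
  obtain ⟨a, b, c, ha, hb, hc, he⟩ := h m
  have hn := congrArg norm he
  have h1 : ‖(c : ℂ) * p m‖ = c * ‖p m‖ := by
    rw [norm_mul, Complex.norm_real, Real.norm_eq_abs, abs_of_pos (by linarith)]
  have h2 : ‖(a : ℂ) * p (m + 1) + b * p (m - 1)‖ ≤ a * ‖p m‖ + b * ‖p m‖ := by
    refine (norm_add_le _ _).trans ?_
    rw [norm_mul, norm_mul, Complex.norm_real, Complex.norm_real, Real.norm_eq_abs,
      Real.norm_eq_abs, abs_of_nonneg ha, abs_of_nonneg hb]
    gcongr <;> exact hle _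
  rw [h1] at hn
  have h3 : 0 < ‖p m‖ := lt_of_lt_of_le (by positivity) hpm
  nlinarith

theorem edgeLength_pos {ϑ : ℝ} (hϑ : |ϑ| < Real.pi) (e : Edge) : 0 < edgeLength ϑ e := by
  rw [abs_lt] at hϑ
  unfold edgeLength
  split_ifs <;> linarith [Real.pi_pos]

theorem edgeLength_zero (e : Edge) : edgeLength 0 e = Real.pi := by
  simp [edgeLength]

/-- Constants that exist on every edge can be chosen uniformly. -/
theorem exists_uniform_const {P : ℝ → ℝ → Prop}
    (hmono : ∀ ℓ K K', K ≤ K' → P ℓ K → P ℓ K') (h : ∀ ℓ, 0 < ℓ → ∃ K, 0 ≤ K ∧ P ℓ K)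
    {ϑ : ℝ} (hϑ : |ϑ| < Real.pi) : ∃ K, 0 ≤ K ∧ ∀ e, P (edgeLength ϑ e) K := by
  have h' := abs_lt.1 hϑ
  -- Only three edge lengths occur in the chain.
  obtain ⟨K₁, h₁, hK₁⟩ := h (Real.pi + ϑ) (by linarith)
  obtain ⟨K₂, h₂, hK₂⟩ := h (Real.pi - ϑ) (by linarith)
  obtain ⟨K₃, h₃, hK₃⟩ := h Real.pi Real.pi_pos
  refine ⟨K₁ + K₂ + K₃, by positivity, fun e => ?_⟩
  unfold edgeLength
  split_ifs
  · exact hmono _ _ _ (by linarith) hK₁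
  · exact hmono _ _ _ (by linarith) hK₂
  · exact hmono _ _ _ (by linarith) hK₃

/-- The contribution `tanh (κ ℓ / 2)` of an edge to the flux of a locally constant function. -/
def edgeWeight (κ ℓ : ℝ) : ℝ := (Real.cosh (κ * ℓ) - 1) / Real.sinh (κ * ℓ)

theorem DeltaCoupling.left_eq {ϑ α : ℝ} {u v : Edge → ℝ → ℂ} (h : DeltaCoupling ϑ α u v) (e : Edge) :
    u e 0 = u (e.1, true) 0 := by
  obtain ⟨j, _ | _⟩ := e
  · exact h.lower_left j
  · rfl

theorem DeltaCoupling.right_eq {ϑ α : ℝ} {u v : Edge → ℝ → ℂ} (h : DeltaCoupling ϑ α u v)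
    (e : Edge) : u e (edgeLength ϑ e) = u (e.1 + 1, true) 0 := by
  obtain ⟨j, _ | _⟩ := e
  · simpa using h.lower_right (j + 1)
  · simpa using h.upper_right (j + 1)

/-- `-κ²` is not an eigenvalue if every vertex satisfies a positivity condition. -/
theorem eq_zero_of_mem_graph {ϑ α κ : ℝ} (hϑ : |ϑ| < Real.pi) (hκ : 0 < κ)
    (hpos : ∀ j : ℤ, 0 < α + κ * (edgeWeight κ (edgeLength ϑ (j, true))
      + edgeWeight κ (edgeLength ϑ (j, false)) + edgeWeight κ (edgeLength ϑ (j - 1, true))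
      + edgeWeight κ (edgeLength ϑ (j - 1, false))))
    {ψ : StateSpace ϑ} (h : (ψ, (-(κ : ℂ) ^ 2) • ψ) ∈ hamiltonianGraph ϑ α) : ψ = 0 := by
  obtain ⟨u, v, hr, hd⟩ := h
  set p : ℤ → ℂ := fun j => u (j, true) 0 with hp
  have hr' : ∀ e, ψ e = edgeSolMap (edgeLength ϑ e) κ (p e.1, p (e.1 + 1)) ∧
      ∀ x ∈ Icc 0 (edgeLength ϑ e),
        v e x = edgeSolDeriv (edgeLength ϑ e) κ (p e.1) (p (e.1 + 1)) x := fun e => by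
    have h1 : IsSobolevRep (edgeLength ϑ e) (ψ e) ((κ : ℂ) ^ 2 • ψ e) (u e) (v e) := by
      have he : -(((-(κ : ℂ) ^ 2) • ψ : StateSpace ϑ) e) = (κ : ℂ) ^ 2 • ψ e := by
        change -((-(κ : ℂ) ^ 2) • ψ e) = _
        rw [neg_smul, neg_neg]
      exact he ▸ hr e
    have := h1.eq_edgeSol (edgeLength_pos hϑ e) hκ
    rwa [hd.left_eq, hd.right_eq] at this
  obtain ⟨K, hK, hK'⟩ := exists_uniform_const
    (P := fun ℓ K => ∀ p q : ℂ, ‖p‖ ≤ K * ‖edgeSolMap ℓ κ (p, q)‖)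
    (fun ℓ K K' hKK h p q => (h p q).trans (by gcongr))
    (fun ℓ hℓ => exists_norm_le_edgeSolMap hℓ hκ) hϑ
  have hsum : Summable fun j => ‖p j‖ ^ 2 := by
    have hinj : Function.Injective fun j : ℤ => ((j, true) : Edge) := fun i j hij =>
      (Prod.mk.inj hij).1
    have := ((sqSumLE_lp ψ).comp_injective hinj).const_mul K
    refine (this.mono (fun j => norm_nonneg (p j)) fun j => ?_).summable
    rw [(hr' (j, true)).1]
    exact hK' (j, true) _ _
  have hz : ∀ j, p j = 0 := by
    refine eq_zero_of_subharmonic hsum fun j => ?_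
    have hflux := hd.flux j
    have e0 : ∀ b, v (j, b) 0 = _ := fun b =>
      (hr' (j, b)).2 0 ⟨le_rfl, (edgeLength_pos hϑ _).le⟩
    have e1 : ∀ b, v (j - 1, b) (edgeLength ϑ (j - 1, b)) = _ := fun b =>
      (hr' (j - 1, b)).2 _ ⟨(edgeLength_pos hϑ _).le, le_rfl⟩
    rw [e0, e0, e1, e1, edgeSolDeriv_left, edgeSolDeriv_left, edgeSolDeriv_right,
      edgeSolDeriv_right] at hflux
    simp only [sub_add_cancel] at hflux
    have hS : ∀ e, 0 < Real.sinh (κ * edgeLength ϑ e) := fun e =>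
      sinh_mul_pos (edgeLength_pos hϑ e) hκ
    have hw : ∀ e, κ * edgeWeight κ (edgeLength ϑ e) =
        κ / Real.sinh (κ * edgeLength ϑ e) * Real.cosh (κ * edgeLength ϑ e)
          - κ / Real.sinh (κ * edgeLength ϑ e) := fun e => by
      rw [edgeWeight]; ring
    have hx : ∀ e, 0 ≤ κ / Real.sinh (κ * edgeLength ϑ e) := fun e => (div_pos hκ (hS e)).le
    have hj := hpos j
    rw [mul_add, mul_add, mul_add, hw, hw, hw, hw] at hj
    -- The flux condition solved for `p j`: each adjacent edge contributes $\kappa/\sinh\kappa\ell$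
    -- to the neighbour's coefficient and $\kappa\coth\kappa\ell$ to that of `p j`. The difference
    -- of the two is $\kappa$ times `edgeWeight`, so `hpos` is exactly strict dominance.
    refine ⟨κ / Real.sinh (κ * edgeLength ϑ (j, true))
        + κ / Real.sinh (κ * edgeLength ϑ (j, false)),
      κ / Real.sinh (κ * edgeLength ϑ (j - 1, true))
        + κ / Real.sinh (κ * edgeLength ϑ (j - 1, false)),
      α + (κ / Real.sinh (κ * edgeLength ϑ (j, true)) * Real.cosh (κ * edgeLength ϑ (j, true))
        + κ / Real.sinh (κ * edgeLength ϑ (j, false)) * Real.cosh (κ * edgeLength ϑ (j, false))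
        + κ / Real.sinh (κ * edgeLength ϑ (j - 1, true))
          * Real.cosh (κ * edgeLength ϑ (j - 1, true))
        + κ / Real.sinh (κ * edgeLength ϑ (j - 1, false))
          * Real.cosh (κ * edgeLength ϑ (j - 1, false))),
      add_nonneg (hx _) (hx _), add_nonneg (hx _) (hx _), by linarith, ?_⟩
    simp only [Complex.ofReal_add, Complex.ofReal_mul] at hflux ⊢
    linear_combination (-1 : ℂ) * hflux
  ext1
  funext e
  rw [(hr' e).1, hz, hz]
  exact map_zero (edgeSolMap (edgeLength ϑ e) κ)

/-! ### The resolvent set of the straight chain -/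

section Resolvent

variable {H : Type*} [NormedAddCommGroup H] [NormedSpace ℂ H]

/-- Uniqueness makes any choice of solutions linear in `f`, and the norm bound makes it continuous;
so a bounded inverse results without exhibiting a linear solution formula. -/
theorem mem_resolventSet_of_graph {T : H →ₗ.[ℂ] H} {z : ℂ}
    (hinj : ∀ ψ, (ψ, z • ψ) ∈ T.graph → ψ = 0) {K : ℝ}
    (hsurj : ∀ f, ∃ ψ, (ψ, f + z • ψ) ∈ T.graph ∧ ‖ψ‖ ≤ K * ‖f‖) : z ∈ resolventSet T := by
  have huniq : ∀ f ψ ψ', (ψ, f + z • ψ) ∈ T.graph → (ψ', f + z • ψ') ∈ T.graph → ψ = ψ' := by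
    intro f ψ ψ' h h'
    have := T.graph.sub_mem h h'
    rw [Prod.mk_sub_mk, add_sub_add_left_eq_sub, ← smul_sub] at this
    exact sub_eq_zero.1 (hinj _ this)
  choose R hR hRn using hsurj
  let R' : H →ₗ[ℂ] H :=
    { toFun := R
      map_add' := fun f g => by
        refine huniq (f + g) _ _ (hR _) ?_
        have := T.graph.add_mem (hR f) (hR g)
        rw [Prod.mk_add_mk] at this
        convert this using 2
        rw [smul_add]; abel
      map_smul' := fun c f => by
        refine huniq (c • f) _ _ (hR _) ?_
        have := T.graph.smul_mem c (hR f)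
        rw [Prod.smul_mk] at this
        rw [RingHom.id_apply]
        convert this using 2
        rw [smul_add, smul_comm] }
  refine ⟨R'.mkContinuous K hRn, fun f => ?_, fun ψ => ?_⟩
  · obtain ⟨ψ, h1, h2⟩ := (T.mem_graph_iff).1 (hR f)
    refine ⟨ψ, h1, ?_⟩
    rw [h2, h1]
    exact add_sub_cancel_right _ _
  · refine huniq _ _ _ (hR _) ?_
    rw [sub_add_cancel]
    exact T.mem_graph ψ

end Resolvent

/-- The translation by `n` in `ℓ²(ℤ)`. -/
def shift (n : ℤ) : lp (fun _ : ℤ => ℂ) 2 →L[ℂ] lp (fun _ : ℤ => ℂ) 2 :=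
  LinearMap.mkContinuous
    { toFun := fun x => ⟨fun j => x (j + n),
        ((sqSumLE_lp x).comp_injective (add_left_injective n)).memℓp⟩
      map_add' := fun _ _ => rfl
      map_smul' := fun _ _ => rfl } 1 fun x => by
    rw [one_mul]
    exact SqSumLE.norm_le ((sqSumLE_lp x).comp_injective (add_left_injective n)) (norm_nonneg x)

theorem norm_shift_le (n : ℤ) : ‖shift n‖ ≤ 1 :=
  LinearMap.mkContinuous_norm_le _ zero_le_one _

theorem exists_sol_recurrence {η : ℝ} (hη : 1 < η) :
    ∃ K, 0 ≤ K ∧ ∀ (g : ℤ → ℂ) (B : ℝ), SqSumLE (fun j => ‖g j‖) B →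
      ∃ p : ℤ → ℂ, SqSumLE (fun j => ‖p j‖) (K * B) ∧
        ∀ j, p (j + 1) + p (j - 1) - 2 * η * p j = g j := by
  have hη0 : (η : ℂ) ≠ 0 := by exact_mod_cast (by linarith : η ≠ 0)
  -- The recurrence is $-2\eta(1-T)p=g$ with $\|T\|\le 1/\eta<1$, so $1-T$ is invertible by a
  -- Neumann series.
  set T := ((2 * η : ℂ)⁻¹) • (shift 1 + shift (-1)) with hT
  have hT1 : ‖T‖ < 1 := by
    have h1 := norm_add_le (shift 1) (shift (-1))
    have h2 := norm_shift_le 1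
    have h3 := norm_shift_le (-1)
    have h4 : ‖(2 * η : ℂ)⁻¹‖ = (2 * η)⁻¹ := by
      rw [norm_inv, norm_mul, Complex.norm_real, Real.norm_eq_abs, abs_of_pos (by linarith)]
      norm_num
    rw [hT, norm_smul, h4, inv_mul_lt_iff₀ (by linarith)]
    linarith
  set N := ((Units.oneSub T hT1)⁻¹ : (lp (fun _ : ℤ => ℂ) 2 →L[ℂ] lp (fun _ : ℤ => ℂ) 2)ˣ)
  set R := (-(2 * η : ℂ)⁻¹) • (N : lp (fun _ : ℤ => ℂ) 2 →L[ℂ] lp (fun _ : ℤ => ℂ) 2) with hR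
  refine ⟨‖R‖ ^ 2, sq_nonneg _, fun g B hg => ?_⟩
  have hB : 0 ≤ B := by simpa using hg ∅
  set x : lp (fun _ : ℤ => ℂ) 2 := ⟨g, hg.memℓp⟩ with hx
  have hxB : ‖x‖ ^ 2 ≤ B := by
    have : ‖x‖ ≤ √B := SqSumLE.norm_le (by rw [Real.sq_sqrt hB]; exact hg) (Real.sqrt_nonneg _)
    calc ‖x‖ ^ 2 ≤ √B ^ 2 := by gcongr
      _ = B := Real.sq_sqrt hB
  refine ⟨R x, fun s => (sqSumLE_lp (R x) s).trans ?_, fun j => ?_⟩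
  · calc ‖R x‖ ^ 2 ≤ (‖R‖ * ‖x‖) ^ 2 := by gcongr; exact R.le_opNorm x
      _ = ‖R‖ ^ 2 * ‖x‖ ^ 2 := mul_pow _ _ _
      _ ≤ ‖R‖ ^ 2 * B := by gcongr
  · have h1 : (1 - T) * (N : lp (fun _ : ℤ => ℂ) 2 →L[ℂ] lp (fun _ : ℤ => ℂ) 2) = 1 :=
      (Units.oneSub T hT1).mul_inv
    have h2 : (shift 1 + shift (-1)) (R x) - (2 * η : ℂ) • R x = x := by
      have h3 : ∀ y, (shift 1 + shift (-1)) y = (2 * η : ℂ) • T y := fun y => by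
        change _ = (2 * η : ℂ) • (2 * η : ℂ)⁻¹ • (shift 1 + shift (-1)) y
        rw [smul_smul, mul_inv_cancel₀ (by simpa using hη0), one_smul]
      have h4 : (N : lp (fun _ : ℤ => ℂ) 2 →L[ℂ] lp (fun _ : ℤ => ℂ) 2) x
          - T ((N : lp (fun _ : ℤ => ℂ) 2 →L[ℂ] lp (fun _ : ℤ => ℂ) 2) x) = x :=
        DFunLike.congr_fun h1 x
      have h5 : R x = (-(2 * η : ℂ)⁻¹) •
          (N : lp (fun _ : ℤ => ℂ) 2 →L[ℂ] lp (fun _ : ℤ => ℂ) 2) x := rfl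
      rw [h3, h5, T.map_smul, ← smul_sub, ← smul_sub, smul_smul, mul_neg,
        mul_inv_cancel₀ (by simpa using hη0), neg_one_smul, neg_sub]
      exact h4
    exact congrArg (fun y : lp (fun _ : ℤ => ℂ) 2 => y j) h2

/-- Injectivity is the maximum principle, since the positivity at each vertex equals
$\frac{4\kappa}{\sinh\kappa\pi}(\eta-1)$. For surjectivity, edgewise solutions with free end values
are glued, and the recurrence selects the values that balance the flux. -/
theorem neg_sq_mem_resolventSet {α κ : ℝ} (hκ : 0 < κ)
    (hη : 1 < Real.cosh (κ * Real.pi) + α / (4 * κ) * Real.sinh (κ * Real.pi)) :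
    (-(κ : ℂ) ^ 2) ∈ resolventSet (hamiltonian 0 α) := by
  have h0 : |(0 : ℝ)| < Real.pi := by simpa using Real.pi_pos
  have hS : 0 < Real.sinh (κ * Real.pi) := sinh_mul_pos Real.pi_pos hκ
  obtain ⟨K, hK, hK'⟩ := exists_uniform_const
    (P := fun ℓ K => ∀ f : EdgeL2 ℓ, ∃ a b : ℂ, ‖a‖ ≤ K * ‖f‖ ∧ ‖b‖ ≤ K * ‖f‖ ∧
      ∀ p q : ℂ, ∃ (ψ : EdgeL2 ℓ) (u v : ℝ → ℂ),
        IsSobolevRep ℓ ψ ((κ : ℂ) ^ 2 • ψ - f) u v ∧ u 0 = p ∧ u ℓ = q ∧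
        v 0 = edgeSolDeriv ℓ κ p q 0 + a ∧ v ℓ = edgeSolDeriv ℓ κ p q ℓ + b ∧
        ‖ψ‖ ≤ K * (‖p‖ + ‖q‖ + ‖f‖))
    (fun ℓ K K' hKK h f => by
      obtain ⟨a, b, ha, hb, h⟩ := h f
      refine ⟨a, b, ha.trans (by gcongr), hb.trans (by gcongr), fun p q => ?_⟩
      obtain ⟨ψ, u, v, h1, h2, h3, h4, h5, h6⟩ := h p q
      exact ⟨ψ, u, v, h1, h2, h3, h4, h5, h6.trans (by gcongr)⟩)
    (fun ℓ hℓ => exists_edge_sol hℓ hκ) h0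
  obtain ⟨N, hN, hN'⟩ := exists_sol_recurrence hη
  set η : ℝ := Real.cosh (κ * Real.pi) + α / (4 * κ) * Real.sinh (κ * Real.pi) with hηdef
  -- Multiplying the flux condition by `c` normalizes it to $p_{j+1}+p_{j-1}-2\eta p_j=-c\,d_j$,
  -- where $d_j$ collects the derivative offsets caused by `f`.
  set c : ℝ := Real.sinh (κ * Real.pi) / (2 * κ) with hc
  have hc0 : 0 ≤ c := by positivity
  -- Each addition of families costs a factor 2 in `SqSumLE.add`, and each vertex value is shared by
  -- the two arms of a ring (`SqSumLE.comp_fst`); `Q` collects these factors.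
  set Q : ℝ := K ^ 2 * (2 * (2 * (2 * (N * (c ^ 2 * (K ^ 2 * 16))))
    + 2 * (2 * (N * (c ^ 2 * (K ^ 2 * 16))))) + 2 * 1) with hQ
  have hQ0 : 0 ≤ Q := by positivity
  refine mem_resolventSet_of_graph (K := √Q) (fun ψ h => ?_) fun f => ?_
  · rw [graph_hamiltonian] at h
    refine eq_zero_of_mem_graph h0 hκ (fun j => ?_) h
    simp only [edgeLength_zero, edgeWeight]
    have h1 : α + κ * ((Real.cosh (κ * Real.pi) - 1) / Real.sinh (κ * Real.pi)
        + (Real.cosh (κ * Real.pi) - 1) / Real.sinh (κ * Real.pi)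
        + (Real.cosh (κ * Real.pi) - 1) / Real.sinh (κ * Real.pi)
        + (Real.cosh (κ * Real.pi) - 1) / Real.sinh (κ * Real.pi))
        = 4 * κ / Real.sinh (κ * Real.pi) * (η - 1) := by
      rw [hηdef]; field_simp; ring
    rw [h1]
    exact mul_pos (by positivity) (by linarith)
  · choose a b ha hb hab using fun e => hK' e (f e)
    set d : ℤ → ℂ := fun j => a (j, true) + a (j, false) - b (j - 1, true) - b (j - 1, false)
      with hd
    have hf := sqSumLE_lp f
    have hf0 : ∀ b, SqSumLE (fun j : ℤ => ‖f (j, b)‖) (‖f‖ ^ 2) := fun b =>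
      hf.comp_injective (σ := fun j : ℤ => ((j, b) : Edge)) fun i j hij => by simpa using hij
    have hf1 : ∀ b, SqSumLE (fun j : ℤ => ‖f (j - 1, b)‖) (‖f‖ ^ 2) := fun b =>
      hf.comp_injective (σ := fun j : ℤ => ((j - 1, b) : Edge)) fun i j hij => by simpa using hij
    have hd' : SqSumLE (fun j => ‖d j‖) (K ^ 2 * 16 * ‖f‖ ^ 2) := by
      have h1 := ((((hf0 true).add (hf0 false)).add
        ((hf1 true).add (hf1 false))).const_mul K).mono (b := fun j => ‖d j‖)
        (fun j => norm_nonneg _) fun j => by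
          have e1 := norm_sub_le (a (j, true) + a (j, false) - b (j - 1, true)) (b (j - 1, false))
          have e2 := norm_sub_le (a (j, true) + a (j, false)) (b (j - 1, true))
          have e3 := norm_add_le (a (j, true)) (a (j, false))
          have e4 := ha (j, true)
          have e5 := ha (j, false)
          have e6 := hb (j - 1, true)
          have e7 := hb (j - 1, false)
          simp only [hd]
          linarith
      convert h1 using 1
      ring
    have hg : SqSumLE (fun j => ‖-(c : ℂ) * d j‖) (c ^ 2 * (K ^ 2 * 16 * ‖f‖ ^ 2)) := by
      refine (hd'.const_mul c).mono (fun j => norm_nonneg _) fun j => ?_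
      rw [norm_mul, norm_neg, Complex.norm_real, Real.norm_eq_abs, abs_of_nonneg hc0]
    obtain ⟨p, hp, hrec⟩ := hN' _ _ hg
    choose ψ u v hr hu0 huℓ hv0 hvℓ hψ using fun e : Edge => hab e (p e.1) (p (e.1 + 1))
    have hψ' : SqSumLE (fun e => ‖ψ e‖) ((√Q * ‖f‖) ^ 2) := by
      rw [mul_pow, Real.sq_sqrt hQ0]
      have h1 := hp.comp_fst
      have h2 := (hp.comp_injective (add_left_injective (1 : ℤ))).comp_fst
      have h3 := (((h1.add h2).add hf).const_mul K).mono (fun e => norm_nonneg _) hψ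
      convert h3 using 1
      rw [hQ]; ring
    refine ⟨⟨ψ, hψ'.memℓp⟩, ?_, SqSumLE.norm_le hψ' (by positivity)⟩
    rw [graph_hamiltonian]
    refine ⟨u, v, fun e => ?_, ?_, ?_, ?_, ?_⟩
    · have := hr e
      convert this using 1
      change -(f e + (-(κ : ℂ) ^ 2) • ψ e) = _
      rw [neg_smul]; abel
    · intro j; rw [hu0, hu0]
    · intro j; rw [huℓ, hu0]; simp
    · intro j; rw [huℓ, hu0]; simp
    · intro j
      rw [hv0, hv0, hvℓ, hvℓ, hu0, edgeSolDeriv_left, edgeSolDeriv_left, edgeSolDeriv_right,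
        edgeSolDeriv_right]
      simp only [edgeLength_zero, sub_add_cancel]
      have h1 := hrec j
      have hκ' : (κ : ℂ) ≠ 0 := by exact_mod_cast hκ.ne'
      have hS' : ((Real.sinh (κ * Real.pi) : ℝ) : ℂ) ≠ 0 := by exact_mod_cast hS.ne'
      rw [hηdef, hc] at h1
      simp only [Complex.ofReal_add, Complex.ofReal_mul, Complex.ofReal_div, Complex.ofReal_ofNat,
        hd] at h1 ⊢
      generalize ((Real.sinh (κ * Real.pi) : ℝ) : ℂ) = S at *
      generalize ((Real.cosh (κ * Real.pi) : ℝ) : ℂ) = C at *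
      have hxy : 2 * ((κ : ℂ) / S) * (S / (2 * κ)) = 1 := by field_simp
      linear_combination 2 * ((κ : ℂ) / S) * h1 + (α * p j - a (j, true) - a (j, false)
        + b (j - 1, true) + b (j - 1, false)) * hxy

/-! ### The even decaying eigenfunction -/

/-- The vertex values of the even function decaying by the factor `r` from ring to ring. -/
def vertexDecay (r : ℝ) (j : ℤ) : ℝ := r ^ (max (j - 1) (-j)).toNat

theorem vertexDecay_succ_nat (r : ℝ) (n : ℕ) : vertexDecay r (n + 1) = r ^ n := by
  unfold vertexDecay
  congr 1
  omega

theorem vertexDecay_neg_nat (r : ℝ) (n : ℕ) : vertexDecay r (-n) = r ^ n := by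
  unfold vertexDecay
  congr 1
  omega

/-- The mirror fixes ring $0$, which lies between vertices $0$ and $1$; hence it exchanges vertices
$-j$ and $j+1$. -/
theorem vertexDecay_neg (r : ℝ) (j : ℤ) : vertexDecay r (-j) = vertexDecay r (j + 1) := by
  unfold vertexDecay
  congr 2
  omega

theorem sqSumLE_vertexDecay {r : ℝ} (h0 : 0 ≤ r) (h1 : r < 1) :
    ∃ B, SqSumLE (fun j => ‖(vertexDecay r j : ℂ)‖) B := by
  have hs : Summable fun n : ℕ => r ^ n * r ^ n := by
    simp only [← mul_pow]
    exact summable_geometric_of_lt_one (by positivity) (by nlinarith)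
  have hsum : Summable fun j : ℤ => ‖(vertexDecay r j : ℂ)‖ ^ 2 := by
    simp only [Complex.norm_real, Real.norm_eq_abs, sq_abs]
    have h2 : Summable fun j : ℤ => vertexDecay r (j + 1) ^ 2 := by
      refine Summable.of_nat_of_neg ?_ ?_
      · simpa only [vertexDecay_succ_nat, sq] using hs
      · have : ∀ n : ℕ, vertexDecay r (-(n : ℤ) + 1) = vertexDecay r n := fun n => by
          rw [← vertexDecay_neg, neg_neg]
        simp only [this]
        rw [← summable_nat_add_iff 1]
        simpa only [Nat.cast_add, Nat.cast_one, vertexDecay_succ_nat, sq] using hs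
    exact (Equiv.addRight (1 : ℤ)).summable_iff.1 h2
  exact ⟨_, fun s => hsum.sum_le_tsum s fun _ _ => sq_nonneg _⟩

theorem edgeLength_of_ne {ϑ : ℝ} {j : ℤ} (hj : j ≠ 0) (b : Bool) :
    edgeLength ϑ (j, b) = Real.pi := by
  simp [edgeLength, hj]

/-- The eigenvalue condition for the even part of the bent chain. -/
theorem isEigenvalue_evenHamiltonian {ϑ α κ r : ℝ} (hϑ : |ϑ| < Real.pi) (hκ : 0 < κ)
    (hr0 : 0 < r) (hr1 : r < 1)
    (hbulk : 2 * (κ / Real.sinh (κ * Real.pi)) * (r ^ 2 + 1 - 2 * Real.cosh (κ * Real.pi) * r)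
      = α * r)
    (hvertex : 2 * (κ / Real.sinh (κ * Real.pi)) * (r - Real.cosh (κ * Real.pi))
      - κ * (edgeWeight κ (Real.pi + ϑ) + edgeWeight κ (Real.pi - ϑ)) = α) :
    IsEigenvalue (evenHamiltonian ϑ α) ((-κ ^ 2 : ℝ) : ℂ) := by
  set p : ℤ → ℂ := fun j => (vertexDecay r j : ℂ) with hp
  obtain ⟨B, hB⟩ := sqSumLE_vertexDecay hr0.le hr1
  set ψ : ∀ e : Edge, EdgeL2 (edgeLength ϑ e) := fun e =>
    edgeSolMap (edgeLength ϑ e) κ (p e.1, p (e.1 + 1)) with hψ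
  obtain ⟨K, hK, hK'⟩ := exists_uniform_const
    (P := fun ℓ K => ∀ p q : ℂ, ‖edgeSolMap ℓ κ (p, q)‖ ≤ K * (‖p‖ + ‖q‖))
    (fun ℓ K K' hKK h p q => (h p q).trans (by gcongr))
    (fun ℓ _ => exists_norm_edgeSolMap_le ℓ κ) hϑ
  have hmem : Memℓp ψ 2 :=
    (((hB.comp_fst.add (hB.comp_injective (add_left_injective (1 : ℤ))).comp_fst).const_mul K).mono
      (fun e => norm_nonneg (ψ e)) fun e => hK' e _ _).memℓp
  set Ψ : StateSpace ϑ := ⟨ψ, hmem⟩ with hΨ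
  have hS : ∀ e, Real.sinh (κ * edgeLength ϑ e) ≠ 0 := fun e =>
    (sinh_mul_pos (edgeLength_pos hϑ e) hκ).ne'
  have heven : Ψ ∈ evenSubspace ϑ := by
    intro j b
    have h1 : Ψ (-j, b) =ᵐ[edgeMeasure (edgeLength ϑ (-j, b))]
        edgeSol (edgeLength ϑ (-j, b)) κ (p (-j)) (p (-j + 1)) :=
      (edgeSolMap_rep _ κ _ _).ae_eq
    have h2 : Ψ (j, b) =ᵐ[edgeMeasure (edgeLength ϑ (j, b))]
        edgeSol (edgeLength ϑ (j, b)) κ (p j) (p (j + 1)) :=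
      (edgeSolMap_rep _ κ _ _).ae_eq
    have e1 : p (-j) = p (j + 1) := by simp only [hp, vertexDecay_neg]
    have e2 : p (-j + 1) = p j := by simp only [hp, ← vertexDecay_neg, neg_neg]
    filter_upwards [ae_reflect h1, h2] with x h3 h4
    rw [h3, h4, edgeLength_neg, e1, e2, edgeSol_reflect]
  have hgraph : (Ψ, (-(κ : ℂ) ^ 2) • Ψ) ∈ hamiltonianGraph ϑ α := by
    refine ⟨fun e => edgeSol (edgeLength ϑ e) κ (p e.1) (p (e.1 + 1)),
      fun e => edgeSolDeriv (edgeLength ϑ e) κ (p e.1) (p (e.1 + 1)), fun e => ?_, ?_, ?_, ?_, ?_⟩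
    · have h1 := edgeSolMap_rep (edgeLength ϑ e) κ (p e.1) (p (e.1 + 1))
      have he : -(((-(κ : ℂ) ^ 2) • Ψ) e) = (κ : ℂ) ^ 2 • Ψ e := by
        change -((-(κ : ℂ) ^ 2) • Ψ e) = _
        rw [neg_smul, neg_neg]
      exact he ▸ h1
    · intro j
      rw [edgeSol_left (hS _), edgeSol_left (hS _)]
    · intro j
      rw [edgeSol_left (hS _), edgeSol_right (hS _), sub_add_cancel]
    · intro j
      rw [edgeSol_left (hS _), edgeSol_right (hS _), sub_add_cancel]
    · intro j
      rw [edgeSol_left (hS _), edgeSolDeriv_left, edgeSolDeriv_left, edgeSolDeriv_right,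
        edgeSolDeriv_right]
      simp only [sub_add_cancel, hp]
      norm_cast
      have hw : ∀ ℓ, κ * edgeWeight κ ℓ =
          κ / Real.sinh (κ * ℓ) * (Real.cosh (κ * ℓ) - 1) := fun ℓ => by
        rw [edgeWeight]; ring
      rw [mul_add, hw, hw] at hvertex
      have ht : edgeLength ϑ (0, true) = Real.pi + ϑ := by simp [edgeLength]
      have hf : edgeLength ϑ (0, false) = Real.pi - ϑ := by simp [edgeLength]
      have bulk : ∀ n : ℕ, 2 * (κ / Real.sinh (κ * Real.pi)) * (r ^ (n + 2) + r ^ n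
          - 2 * Real.cosh (κ * Real.pi) * r ^ (n + 1)) = α * r ^ (n + 1) := fun n => by
        linear_combination r ^ n * hbulk
      have v0 : vertexDecay r 0 = 1 := by simpa using vertexDecay_neg_nat r 0
      have v1 : vertexDecay r 1 = 1 := by simpa using vertexDecay_succ_nat r 0
      have v2 : vertexDecay r 2 = r := by simpa using vertexDecay_succ_nat r 1
      have v3 : vertexDecay r (-1) = r := by simpa using vertexDecay_neg_nat r 1
      -- Vertices $0$ and $1$ are the ends of ring $0$; both carry the value $1$ and yield the same
      -- condition `hvertex`. All other vertices meet only arms of length $\pi$, where the flux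
      -- condition is a power of `r` times `hbulk`.
      obtain h | rfl | rfl | h : 2 ≤ j ∨ j = 1 ∨ j = 0 ∨ j ≤ -1 := by omega
      · obtain ⟨n, hn⟩ := Int.eq_ofNat_of_zero_le (sub_nonneg.2 h)
        obtain rfl : j = n + 2 := by omega
        have a0 : vertexDecay r ((n : ℤ) + 2) = r ^ (n + 1) := by
          rw [← vertexDecay_succ_nat]; congr 1
        have a1 : vertexDecay r ((n : ℤ) + 2 + 1) = r ^ (n + 2) := by
          rw [← vertexDecay_succ_nat]; congr 1
        have a2 : vertexDecay r ((n : ℤ) + 2 - 1) = r ^ n := by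
          rw [← vertexDecay_succ_nat]; congr 1; ring
        simp only [edgeLength_of_ne (show (n : ℤ) + 2 ≠ 0 by omega),
          edgeLength_of_ne (show (n : ℤ) + 2 - 1 ≠ 0 by omega), a0, a1, a2]
        linear_combination bulk n
      · simp only [sub_self, ht, hf, edgeLength_of_ne one_ne_zero]
        norm_num only [v0, v1, v2]
        linear_combination hvertex
      · simp only [ht, hf, edgeLength_of_ne (show (0 : ℤ) - 1 ≠ 0 by norm_num)]
        norm_num only [v0, v1, v3]
        linear_combination hvertex
      · obtain ⟨n, hn⟩ := Int.eq_ofNat_of_zero_le (show 0 ≤ -1 - j by omega)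
        obtain rfl : j = -((n + 1 : ℕ) : ℤ) := by omega
        have a0 := vertexDecay_neg_nat r (n + 1)
        have a1 : vertexDecay r (-((n + 1 : ℕ) : ℤ) + 1) = r ^ n := by
          rw [← vertexDecay_neg_nat]; congr 1; push_cast; ring
        have a2 : vertexDecay r (-((n + 1 : ℕ) : ℤ) - 1) = r ^ (n + 2) := by
          rw [← vertexDecay_neg_nat]; congr 1
        simp only [edgeLength_of_ne (show -((n + 1 : ℕ) : ℤ) ≠ 0 by omega),
          edgeLength_of_ne (show -((n + 1 : ℕ) : ℤ) - 1 ≠ 0 by omega), a0, a1, a2]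
        linear_combination bulk n
  have hne : Ψ ≠ 0 := fun h0 => by
    have h1 : edgeSolMap (edgeLength ϑ (1, true)) κ (p 1, p (1 + 1)) = 0 :=
      congrArg (fun x : StateSpace ϑ => x (1, true)) h0
    rw [map_eq_zero_iff _ (edgeSolMap_injective (edgeLength_pos hϑ _) hκ)] at h1
    have h2 : p 1 = 0 := (Prod.mk.inj h1).1
    have h3 : vertexDecay r 1 = 1 := by simpa using vertexDecay_succ_nat r 0
    simp [hp, h3] at h2
  have hpart : ((⟨Ψ, heven⟩ : evenSubspace ϑ), ((-κ ^ 2 : ℝ) : ℂ) • (⟨Ψ, heven⟩ : evenSubspace ϑ))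
      ∈ (evenHamiltonian ϑ α).graph := by
    rw [evenHamiltonian, graph_partIn, Submodule.mem_comap, graph_hamiltonian]
    have : (((-κ ^ 2 : ℝ) : ℂ)) = -(κ : ℂ) ^ 2 := by push_cast; ring
    rw [this]
    exact hgraph
  obtain ⟨φ, h1, h2⟩ := (evenHamiltonian ϑ α).mem_graph_iff.1 hpart
  refine ⟨φ, ?_, ?_⟩
  · rw [h1]
    exact fun h0 => hne (congrArg Subtype.val h0)
  · rw [h2, h1]

/-! ### Hyperbolic tangents -/

theorem edgeWeight_eq_tanh (κ ℓ : ℝ) (h : 0 < κ * ℓ) :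
    edgeWeight κ ℓ = Real.tanh (κ * ℓ / 2) := by
  have e : κ * ℓ = 2 * (κ * ℓ / 2) := by ring
  have hs : 0 < Real.sinh (κ * ℓ / 2) := Real.sinh_pos_iff.2 (by linarith)
  have hc := Real.cosh_pos (κ * ℓ / 2)
  rw [edgeWeight, Real.tanh_eq_sinh_div_cosh]
  nth_rewrite 1 [e]
  nth_rewrite 2 [e]
  rw [Real.cosh_two_mul, Real.sinh_two_mul, Real.cosh_sq]
  field_simp
  ring

theorem tanh_add_tanh (x y : ℝ) :
    Real.tanh x + Real.tanh y =
      2 * Real.sinh (x + y) / (Real.cosh (x + y) + Real.cosh (x - y)) := by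
  have h1 := Real.cosh_pos x
  have h2 := Real.cosh_pos y
  rw [Real.tanh_eq_sinh_div_cosh, Real.tanh_eq_sinh_div_cosh, Real.cosh_add, Real.cosh_sub,
    Real.sinh_add]
  have h3 : Real.cosh x * Real.cosh y + Real.sinh x * Real.sinh y
    + (Real.cosh x * Real.cosh y - Real.sinh x * Real.sinh y)
      = 2 * (Real.cosh x * Real.cosh y) := by ring
  rw [h3]
  field_simp

theorem tanh_strictMono : StrictMono Real.tanh := fun x y h => by
  have h1 := Real.cosh_pos x
  have h2 := Real.cosh_pos y
  rw [Real.tanh_eq_sinh_div_cosh, Real.tanh_eq_sinh_div_cosh, div_lt_div_iff₀ h1 h2]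
  have := Real.sinh_pos_iff.2 (sub_pos.2 h)
  rw [Real.sinh_sub] at this
  linarith

theorem tanh_pos {x : ℝ} (h : 0 < x) : 0 < Real.tanh x := by
  simpa using tanh_strictMono h

theorem continuous_tanh : Continuous Real.tanh := by
  have : Real.tanh = fun x => Real.sinh x / Real.cosh x :=
    funext Real.tanh_eq_sinh_div_cosh
  rw [this]
  exact Real.continuous_sinh.div Real.continuous_cosh fun x => (Real.cosh_pos x).ne'

theorem mul_tanh_lt {c κ μ : ℝ} (hc : 0 < c) (hκ : 0 < κ) (h : κ < μ) :
    κ * Real.tanh (κ * c) < μ * Real.tanh (μ * c) :=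
  mul_lt_mul h (tanh_strictMono (mul_lt_mul_of_pos_right h hc)).le
    (tanh_pos (mul_pos hκ hc)) (hκ.trans h).le

theorem exists_mul_tanh_eq {c y : ℝ} (hc : 0 < c) (hy : 0 < y) :
    ∃ κ, 0 < κ ∧ κ * Real.tanh (κ * c) = y := by
  have ht := tanh_pos hc
  -- Since $M\ge1$, $M\tanh(Mc)\ge M\tanh c\ge y$, so `M` is an upper end for the intermediate value
  -- theorem.
  set M : ℝ := y / Real.tanh c + 1 with hM
  have hy' : 0 < y / Real.tanh c := div_pos hy ht
  have hM1 : 1 ≤ M := by linarith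
  have hcont : ContinuousOn (fun κ => κ * Real.tanh (κ * c)) (Icc 0 M) :=
    (continuous_id.mul (continuous_tanh.comp (continuous_id.mul continuous_const))).continuousOn
  have hle : y ≤ M * Real.tanh (M * c) := by
    have h1 : Real.tanh c ≤ Real.tanh (M * c) := tanh_strictMono.monotone (by nlinarith)
    calc y = y / Real.tanh c * Real.tanh c := by field_simp
      _ ≤ M * Real.tanh (M * c) := mul_le_mul (by linarith) h1 ht.le (by linarith)
  obtain ⟨κ, hκ, he⟩ := intermediate_value_Icc (by linarith : (0 : ℝ) ≤ M) hcont
    (⟨by simpa using hy.le, hle⟩ : y ∈ Icc _ _)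
  refine ⟨κ, lt_of_le_of_ne hκ.1 fun h0 => ?_, he⟩
  rw [← h0] at he
  simp at he
  exact hy.ne he

/-! ### Dispersion and the secular equation -/

/-- The dispersion function of the straight chain below the lowest band. -/
def dispersion (α κ : ℝ) : ℝ :=
  Real.cosh (κ * Real.pi) + α / (4 * κ) * Real.sinh (κ * Real.pi)

/-- From $\cosh\kappa\pi-1=\sinh\kappa\pi\,\tanh(\kappa\pi/2)$. It replaces $\eta>1$ by a condition
on the increasing function $\kappa\tanh(\kappa\pi/2)$, which is therefore inherited by every larger
$\kappa$. -/
theorem dispersion_sub_one {α κ : ℝ} (hκ : 0 < κ) :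
    dispersion α κ - 1 = Real.sinh (κ * Real.pi) / κ *
      (κ * Real.tanh (κ * (Real.pi / 2)) + α / 4) := by
  have hS := sinh_mul_pos Real.pi_pos hκ
  have h := edgeWeight_eq_tanh κ Real.pi (mul_pos hκ Real.pi_pos)
  rw [mul_div_assoc] at h
  rw [← h, dispersion, edgeWeight]
  field_simp
  ring

theorem one_lt_dispersion_iff {α κ : ℝ} (hκ : 0 < κ) :
    1 < dispersion α κ ↔ -α / 4 < κ * Real.tanh (κ * (Real.pi / 2)) := by
  have hS := sinh_mul_pos Real.pi_pos hκ
  rw [← sub_pos, dispersion_sub_one hκ, mul_pos_iff_of_pos_left (div_pos hS hκ)]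
  constructor <;> intro h <;> linarith

/-- The spectrum of the straight chain lies above `-κ²` when the dispersion function exceeds `1`. -/
theorem lt_of_mem_opSpectrum {α κ s : ℝ} (hκ : 0 < κ) (h : 1 < dispersion α κ)
    (hs : (s : ℂ) ∈ opSpectrum (hamiltonian 0 α)) : -κ ^ 2 < s := by
  by_contra hle
  rw [not_lt] at hle
  have hs0 : 0 ≤ -s := by nlinarith
  have hκμ : κ ≤ √(-s) := Real.le_sqrt_of_sq_le (by linarith)
  have hμ : 0 < √(-s) := hκ.trans_le hκμ
  have hη : 1 < dispersion α √(-s) := by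
    rw [one_lt_dispersion_iff hκ] at h
    rw [one_lt_dispersion_iff hμ]
    rcases hκμ.eq_or_lt with he | hlt
    · rwa [← he]
    · exact h.trans (mul_tanh_lt (by positivity) hκ hlt)
  refine hs ?_
  have h1 := neg_sq_mem_resolventSet hμ hη
  have h2 : -((√(-s) : ℝ) : ℂ) ^ 2 = (s : ℂ) := by
    rw [← Complex.ofReal_pow, Real.sq_sqrt hs0]
    simp
  rwa [h2] at h1

theorem not_isEigenvalue_of_nonneg {ϑ α : ℝ} (hϑ : |ϑ| < Real.pi) (hα : 0 ≤ α) {E : ℝ}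
    (hE : E < 0) : ¬ IsEigenvalue (evenHamiltonian ϑ α) (E : ℂ) := by
  rintro ⟨ψ, hne, he⟩
  have hκ : 0 < √(-E) := Real.sqrt_pos.2 (by linarith)
  have hE2 : (E : ℂ) = -((√(-E) : ℝ) : ℂ) ^ 2 := by
    rw [← Complex.ofReal_pow, Real.sq_sqrt (by linarith)]
    simp
  have hg := (evenHamiltonian ϑ α).mem_graph ψ
  have hgr : (evenHamiltonian ϑ α).graph = _ := graph_partIn _ _
  rw [he, hgr, Submodule.mem_comap, graph_hamiltonian, hE2] at hg
  have hw : ∀ e, 0 < edgeWeight √(-E) (edgeLength ϑ e) := fun e => by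
    have := mul_pos hκ (edgeLength_pos hϑ e)
    rw [edgeWeight_eq_tanh _ _ this]
    exact tanh_pos (by linarith)
  refine hne (Subtype.ext (eq_zero_of_mem_graph hϑ hκ (fun j => ?_) hg))
  have := mul_pos hκ (add_pos (add_pos (add_pos (hw (j, true)) (hw (j, false)))
    (hw (j - 1, true))) (hw (j - 1, false)))
  linarith

/-- The secular equation of the even part of the bent chain has a solution. -/
theorem exists_secular_root {ϑ α κ₀ : ℝ} (h0 : 0 < ϑ) (hπ : ϑ < Real.pi) (hα : α < 0)
    (hκ₀ : 0 < κ₀) (he₀ : κ₀ * Real.tanh (κ₀ * Real.pi) = -α / 2) :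
    ∃ κ, 0 < κ ∧ κ < κ₀ ∧ 1 < dispersion α κ ∧
      √(dispersion α κ ^ 2 - 1) + α / (4 * κ) * Real.sinh (κ * Real.pi)
        + Real.sinh (κ * Real.pi) ^ 2 / (Real.cosh (κ * Real.pi) + Real.cosh (κ * ϑ)) = 0 := by
  have hp2 : 0 < Real.pi / 2 := by positivity
  -- At `κ₁` the dispersion function equals $1$. It lies below `κ₀` because $\tanh x<2\tanh(x/2)$
  -- for $x>0$.
  obtain ⟨κ₁, hκ₁, he₁⟩ := exists_mul_tanh_eq hp2 (show 0 < -α / 4 by linarith)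
  have h10 : κ₁ < κ₀ := by
    by_contra hle
    rw [not_lt] at hle
    have h1 : κ₀ * Real.tanh (κ₀ * (Real.pi / 2)) ≤ -α / 4 := by
      rw [← he₁]
      rcases hle.eq_or_lt with h | h
      · rw [h]
      · exact (mul_tanh_lt hp2 hκ₀ h).le
    have hx : 0 < κ₀ * (Real.pi / 2) := mul_pos hκ₀ hp2
    have h2 := tanh_add_tanh (κ₀ * (Real.pi / 2)) (κ₀ * (Real.pi / 2))
    have h3 : κ₀ * (Real.pi / 2) + κ₀ * (Real.pi / 2) = κ₀ * Real.pi := by ring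
    rw [h3, sub_self, Real.cosh_zero] at h2
    have hS := sinh_mul_pos Real.pi_pos hκ₀
    have hC : 1 < Real.cosh (κ₀ * Real.pi) := Real.one_lt_cosh.2 (mul_pos hκ₀ Real.pi_pos).ne'
    have h4 : Real.tanh (κ₀ * Real.pi) <
        2 * Real.sinh (κ₀ * Real.pi) / (Real.cosh (κ₀ * Real.pi) + 1) := by
      rw [Real.tanh_eq_sinh_div_cosh, div_lt_div_iff₀ (by linarith) (by linarith)]
      nlinarith
    have h5 := mul_lt_mul_of_pos_left (h4.trans_eq h2.symm) hκ₀
    linarith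
  set F : ℝ → ℝ := fun κ => √(dispersion α κ ^ 2 - 1) + α / (4 * κ) * Real.sinh (κ * Real.pi)
        + Real.sinh (κ * Real.pi) ^ 2 / (Real.cosh (κ * Real.pi) + Real.cosh (κ * ϑ)) with hF
  have hcs : ∀ x, Real.sinh x ^ 2 = Real.cosh x ^ 2 - 1 := Real.sinh_sq
  have hFc : ContinuousOn F (Icc κ₁ κ₀) := by
    have hpos : ∀ κ ∈ Icc κ₁ κ₀, 4 * κ ≠ 0 := fun κ hκ => by linarith [hκ.1]
    have hd : ∀ κ, Real.cosh (κ * Real.pi) + Real.cosh (κ * ϑ) ≠ 0 := fun κ =>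
      (add_pos (Real.cosh_pos _) (Real.cosh_pos _)).ne'
    have c1 : ContinuousOn (fun κ => α / (4 * κ) * Real.sinh (κ * Real.pi)) (Icc κ₁ κ₀) :=
      (continuousOn_const.div (by fun_prop) hpos).mul (by fun_prop)
    have c2 : ContinuousOn (dispersion α) (Icc κ₁ κ₀) := ContinuousOn.add (by fun_prop) c1
    have c3 : Continuous fun κ => Real.sinh (κ * Real.pi) ^ 2 /
        (Real.cosh (κ * Real.pi) + Real.cosh (κ * ϑ)) :=
      Continuous.div (by fun_prop) (by fun_prop) hd
    exact ((Real.continuous_sqrt.comp_continuousOn ((c2.pow 2).sub continuousOn_const)).add c1).add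
      c3.continuousOn
  -- The root vanishes and the remainder, with $C=\cosh\kappa_1\pi$, is
  -- $(1-C)+(C^2-1)/(C+\cosh\kappa_1\vartheta)$, negative because $\cosh\kappa_1\vartheta>1$.
  have hF1 : F κ₁ < 0 := by
    have hd : dispersion α κ₁ = 1 := by
      have := dispersion_sub_one (α := α) hκ₁
      rw [he₁] at this
      linarith
    have h1 : α / (4 * κ₁) * Real.sinh (κ₁ * Real.pi) = 1 - Real.cosh (κ₁ * Real.pi) := by
      rw [← hd, dispersion]; ring
    have hC : 1 < Real.cosh (κ₁ * Real.pi) := Real.one_lt_cosh.2 (mul_pos hκ₁ Real.pi_pos).ne'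
    have hc : 1 < Real.cosh (κ₁ * ϑ) := Real.one_lt_cosh.2 (mul_pos hκ₁ h0).ne'
    have h2 : Real.sinh (κ₁ * Real.pi) ^ 2 / (Real.cosh (κ₁ * Real.pi) + Real.cosh (κ₁ * ϑ))
        < Real.cosh (κ₁ * Real.pi) - 1 := by
      rw [div_lt_iff₀ (by linarith), hcs]
      nlinarith
    simp only [hF]
    rw [hd, h1]
    norm_num
    linarith
  -- The equation for `κ₀` turns the middle term into $-\sinh^2\kappa_0\pi/(2\cosh\kappa_0\pi)$,
  -- which the last term outweighs since $\cosh\kappa_0\vartheta<\cosh\kappa_0\pi$.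
  have hF0 : 0 < F κ₀ := by
    have hC : 1 < Real.cosh (κ₀ * Real.pi) := Real.one_lt_cosh.2 (mul_pos hκ₀ Real.pi_pos).ne'
    have hS := sinh_mul_pos Real.pi_pos hκ₀
    have hc : Real.cosh (κ₀ * ϑ) < Real.cosh (κ₀ * Real.pi) := by
      rw [Real.cosh_lt_cosh, abs_of_pos (mul_pos hκ₀ h0), abs_of_pos (mul_pos hκ₀ Real.pi_pos)]
      exact mul_lt_mul_of_pos_left hπ hκ₀
    have hc0 := Real.cosh_pos (κ₀ * ϑ)
    have h1 : α / (4 * κ₀) * Real.sinh (κ₀ * Real.pi)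
        = -(Real.sinh (κ₀ * Real.pi) ^ 2 / (2 * Real.cosh (κ₀ * Real.pi))) := by
      have : α = -2 * (κ₀ * Real.tanh (κ₀ * Real.pi)) := by rw [he₀]; ring
      rw [this, Real.tanh_eq_sinh_div_cosh]
      field_simp
      ring
    have h2 : Real.sinh (κ₀ * Real.pi) ^ 2 / (2 * Real.cosh (κ₀ * Real.pi)) <
        Real.sinh (κ₀ * Real.pi) ^ 2 / (Real.cosh (κ₀ * Real.pi) + Real.cosh (κ₀ * ϑ)) :=
      div_lt_div_of_pos_left (by positivity) (by linarith) (by linarith)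
    have h3 := Real.sqrt_nonneg (dispersion α κ₀ ^ 2 - 1)
    simp only [hF]
    linarith
  obtain ⟨κ, hκ, hFκ⟩ := intermediate_value_Ioo h10.le hFc ⟨hF1, hF0⟩
  have hκ0 : 0 < κ := hκ₁.trans hκ.1
  refine ⟨κ, hκ0, hκ.2, ?_, hFκ⟩
  rw [one_lt_dispersion_iff hκ0, ← he₁]
  exact mul_tanh_lt hp2 hκ₁ hκ.1

theorem isEigenvalue_of_secular {ϑ α κ : ℝ} (hϑ : |ϑ| < Real.pi) (hκ : 0 < κ)
    (hη : 1 < dispersion α κ)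
    (h : √(dispersion α κ ^ 2 - 1) + α / (4 * κ) * Real.sinh (κ * Real.pi)
      + Real.sinh (κ * Real.pi) ^ 2 / (Real.cosh (κ * Real.pi) + Real.cosh (κ * ϑ)) = 0) :
    IsEigenvalue (evenHamiltonian ϑ α) ((-κ ^ 2 : ℝ) : ℂ) := by
  have hS := sinh_mul_pos Real.pi_pos hκ
  have hϑ' := abs_lt.1 hϑ
  set η := dispersion α κ with hηdef
  set q := √(η ^ 2 - 1) with hq
  have hq2 : q ^ 2 = η ^ 2 - 1 := Real.sq_sqrt (by nlinarith)
  have hq0 : 0 ≤ q := Real.sqrt_nonneg _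
  have hη' : η = Real.cosh (κ * Real.pi) + α / (4 * κ) * Real.sinh (κ * Real.pi) := rfl
  have hα : α / (4 * κ) * Real.sinh (κ * Real.pi) = η - Real.cosh (κ * Real.pi) := by
    rw [hη']; ring
  have hα' : α = 4 * (κ / Real.sinh (κ * Real.pi)) * (η - Real.cosh (κ * Real.pi)) := by
    rw [← hα]; field_simp
  have hw : edgeWeight κ (Real.pi + ϑ) + edgeWeight κ (Real.pi - ϑ) =
      2 * Real.sinh (κ * Real.pi) / (Real.cosh (κ * Real.pi) + Real.cosh (κ * ϑ)) := by
    rw [edgeWeight_eq_tanh _ _ (mul_pos hκ (by linarith)),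
      edgeWeight_eq_tanh _ _ (mul_pos hκ (by linarith)), tanh_add_tanh]
    congr <;> ring
  -- The roots of $r^2-2\eta r+1=0$ have product $1$; this is the one in $(0,1)$.
  refine isEigenvalue_evenHamiltonian (r := η - q) hϑ hκ ?_ ?_ ?_ ?_
  · nlinarith
  · nlinarith
  · have h1 : (η - q) ^ 2 + 1 - 2 * Real.cosh (κ * Real.pi) * (η - q)
        = 2 * (η - Real.cosh (κ * Real.pi)) * (η - q) := by
      linear_combination hq2
    rw [h1]
    linear_combination (-(η - q)) * hα'
  · rw [hw]
    rw [hα] at h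
    refine Eq.trans ?_ hα'.symm
    have hd : 0 < Real.cosh (κ * Real.pi) + Real.cosh (κ * ϑ) :=
      add_pos (Real.cosh_pos _) (Real.cosh_pos _)
    have h2 : q = -(η - Real.cosh (κ * Real.pi))
        - Real.sinh (κ * Real.pi) ^ 2 / (Real.cosh (κ * Real.pi) + Real.cosh (κ * ϑ)) := by
      linarith
    rw [h2]
    field_simp
    ring

end BentChain

end

theorem mainTheorem3 (ϑ α : ℝ) (hϑ : ϑ ∈ Set.Ioo 0 Real.pi) :
    (0 ≤ α → ∀ E : ℝ, E < 0 → ¬ BentChain.IsEigenvalue (BentChain.evenHamiltonian ϑ α) (E : ℂ)) ∧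
    (α < 0 →
      ∃ κ₀ : ℝ, (0 < κ₀ ∧ κ₀ * Real.tanh (κ₀ * Real.pi) = -α / 2) ∧
        (∀ κ : ℝ, 0 < κ → κ * Real.tanh (κ * Real.pi) = -α / 2 → κ = κ₀) ∧
        ∃ E : ℝ, E < 0 ∧ BentChain.IsEigenvalue (BentChain.evenHamiltonian ϑ α) (E : ℂ) ∧
          -κ₀ ^ 2 < E ∧
          ∀ s : ℝ, (s : ℂ) ∈ BentChain.opSpectrum (BentChain.hamiltonian 0 α) → E < s) := by
  have hϑ' : |ϑ| < Real.pi := by rw [abs_of_pos hϑ.1]; exact hϑ.2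
  refine ⟨fun hα E hE => BentChain.not_isEigenvalue_of_nonneg hϑ' hα hE, fun hα => ?_⟩
  obtain ⟨κ₀, hκ₀, he₀⟩ := BentChain.exists_mul_tanh_eq Real.pi_pos (show 0 < -α / 2 by linarith)
  obtain ⟨κ, hκ, hlt, hη, hsec⟩ := BentChain.exists_secular_root hϑ.1 hϑ.2 hα hκ₀ he₀
  refine ⟨κ₀, ⟨hκ₀, he₀⟩, fun μ hμ he => ?_, -κ ^ 2, by nlinarith,
    BentChain.isEigenvalue_of_secular hϑ' hκ hη hsec, by nlinarith,
    fun s hs => BentChain.lt_of_mem_opSpectrum hκ hη hs⟩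
  rcases lt_trichotomy μ κ₀ with h | h | h
  · have := BentChain.mul_tanh_lt Real.pi_pos hμ h
    linarith
  · exact h
  · have := BentChain.mul_tanh_lt Real.pi_pos hκ₀ h
    linarith
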